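/- Let $\rho=\beta+i\gamma$, $\rho'=\beta'+i\gamma'$ denote non-trivial zeros of the Riemann zeta-function $\zeta(s)$, that is, zeros with $0<\beta,\beta'<1$. All counts of zeros and of pairs of zeros are with multiplicity. Let $N(T)$ be the number of zeros with $0<\gamma\le T$, and put $L=\frac{1}{2\pi}\log T$. For $M>0$ let $$\mathcal P(T,M)=\Big\{(\rho,\rho') : \tfrac{T}{\log^2 T}<\gamma,\gamma'\le T,\ |(\gamma-\gamma')L|\le M\Big\}.$$ Hypothesis AH-Pairs: for every $M>0$ there is a positive decreasing function $R(T)$ with $R(T)\to0$ as $T\to\infty$ such that, for all sufficiently large $T$ and every $(\rho,\rho')\in\mathcal P(T,M)$, there is an integer $k$ with $$(\gamma-\gamma')L=\frac k2+O\big((|k|+1)R(T)\big),$$ where the implied constant does not depend on $T$, on the pair or on $k$. Fix any $M>0$, let $\mathcal B_0(T)$ be the set of pairs in $\mathcal P(T,M)$ with $-\frac14<(\gamma-\gamma')L\le\frac14$, let $P_0(T)=(TL)^{-1}|\mathcal B_0(T)|$, and let $p_0=\lim_{T\to\infty}P_0(T)$, provided that this limit exists. Corollary. Assume AH-Pairs.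 If $p_0$ exists and $p_0=1$, then asymptotically $100\%$ of the non-trivial zeros of $\zeta(s)$ are both simple and on the critical line, that is, $$\lim_{T\to\infty}\frac{\#\{\rho : 0<\gamma\le T,\ \rho \text{ is simple and } \beta=\tfrac12\}}{N(T)}=1.$$ -/

import Mathlib

open Filter Topology

noncomputable section

namespace ZetaPairs

/-- The non-trivial zeros `ρ = β + iγ` of the Riemann zeta-function: those with `0 < β < 1`. -/
def nontrivialZeros : Set ℂ := {ρ : ℂ | riemannZeta ρ = 0 ∧ 0 < ρ.re ∧ ρ.re < 1}

theorem finite_nontrivialZeros_between (a b : ℝ) :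
    {ρ : ℂ | ρ ∈ nontrivialZeros ∧ a < ρ.im ∧ ρ.im ≤ b}.Finite := by
  have hK : IsCompact (Set.Icc (0 : ℝ) 1 ×ℂ Set.Icc a b) := isCompact_Icc.reProdIm isCompact_Icc
  refine hK.inter_riemannZetaZeros_finite.subset ?_
  rintro ρ ⟨⟨h0, h1, h2⟩, h3, h4⟩
  exact ⟨⟨⟨h1.le, h2.le⟩, ⟨h3.le, h4⟩⟩, h0⟩

/-- The finite set of distinct non-trivial zeros `β + iγ` with `a < γ ≤ b`. -/
def zerosBetween (a b : ℝ) : Finset ℂ := (finite_nontrivialZeros_between a b).toFinset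

/-- The multiplicity `m_ρ` of `ρ` as a zero of the Riemann zeta-function. -/
def mult (ρ : ℂ) : ℕ := analyticOrderNatAt riemannZeta ρ

/-- `N(T)`: the number of zeros with `0 < γ ≤ T`, counted with multiplicity. -/
def zeroCount (T : ℝ) : ℕ := ∑ ρ ∈ zerosBetween 0 T, mult ρ

open Classical in
/-- The number of zeros with `0 < γ ≤ T` that are both simple and on the critical line. -/
def simpleCriticalZeroCount (T : ℝ) : ℕ :=
  ((zerosBetween 0 T).filter (fun ρ => mult ρ = 1 ∧ ρ.re = 1 / 2)).card

/-- `L = (log T) / (2π)`. -/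
def L (T : ℝ) : ℝ := Real.log T / (2 * Real.pi)

open Classical in
/-- `𝒫(T, M)`: the pairs of zeros (`ρ = ρ'` allowed) `(ρ, ρ')` with `T / log² T < γ, γ' ≤ T` and
`|(γ - γ') L| ≤ M`. Multiplicities are taken into account when the pairs are counted. -/
def closePairs (T M : ℝ) : Finset (ℂ × ℂ) :=
  (zerosBetween (T / Real.log T ^ 2) T ×ˢ zerosBetween (T / Real.log T ^ 2) T).filter
    (fun p => |(p.1.im - p.2.im) * L T| ≤ M)

/-- The Alternative Hypothesis for pairs of zeros: for every `M > 0`, all pairs in `𝒫(T, M)` satisfy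
`(γ - γ') L = k / 2 + O((|k| + 1) R(T))` with some integer `k` (depending on the pair), for
sufficiently large `T`, where `R` is positive, decreasing and tends to `0`. -/
def AHPairs : Prop :=
  ∀ M : ℝ, 0 < M → ∃ R : ℝ → ℝ, ∃ C T₀ : ℝ,
    (∀ T, T₀ ≤ T → 0 < R T) ∧ AntitoneOn R (Set.Ici T₀) ∧ Tendsto R atTop (𝓝 0) ∧
    ∀ T, T₀ ≤ T → ∀ p ∈ closePairs T M, ∃ k : ℤ,
      |(p.1.im - p.2.im) * L T - (k : ℝ) / 2| ≤ C * ((|(k : ℝ)| + 1) * R T)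

open Classical in
/-- `ℬ_{k/2}(T)`: the pairs in `𝒫(T, M)` with `k/2 - 1/4 < (γ - γ') L ≤ k/2 + 1/4`. -/
def pairsNear (M : ℝ) (k : ℤ) (T : ℝ) : Finset (ℂ × ℂ) :=
  (closePairs T M).filter (fun p =>
    (k : ℝ) / 2 - 1 / 4 < (p.1.im - p.2.im) * L T ∧
      (p.1.im - p.2.im) * L T ≤ (k : ℝ) / 2 + 1 / 4)

/-- The density `P_{k/2}(T) = (T L)⁻¹ |ℬ_{k/2}(T)|`, the pairs being counted with multiplicity. -/
def pairDensity (M : ℝ) (k : ℤ) (T : ℝ) : ℝ :=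
  (T * L T)⁻¹ * ∑ p ∈ pairsNear M k T, ((mult p.1 * mult p.2 : ℕ) : ℝ)

/-- The limiting density `p_{k/2} = lim_{T → ∞} P_{k/2}(T)` exists and equals `p`. -/
def HasLimitingDensity (M : ℝ) (k : ℤ) (p : ℝ) : Prop :=
  Tendsto (fun T : ℝ => pairDensity M k T) atTop (𝓝 p)

end ZetaPairs

end

/-! Diagonal pairs and reflected pairs both have difference zero in their ordinates, so they are
counted in `pairCount`. Write m, m' for the multiplicities of ρ and 1 - conj ρ. A zero contributes
m², plus m·m' if it is off the line. This is at least 2m, except for a simple zero on the line,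
where it falls short by exactly 1. Summing gives 2N(T) - o(TL) ≤ (simple critical zeros) +
`pairCount`, as in `two_mul_sum_mult_le`. Since `pairCount` ~ TL, the result follows once N(T) ~ TL
is known.

The upper half of N(T) ~ TL also comes from the diagonal pairs: they give N(T) - N(T / log² T) ≤
`pairCount`, and iteration bounds the initial segment.

The lower half, `eventually_le_zeroCount`, is Tauberian. At s = 2n + 2 the completed zeta-function
has logarithm at least n log n - O(n) by Stirling. A Hadamard-type product bound turns this into a
lower bound for Σ m log(1 + x²/γ²) with x = 2n + 2 (`exists_le_sum_log_zeros`). The upper bound for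
N makes the same sum at most (1 + ε) n log n + O(n). There is thus no room for N(T) to fall below (1
- η)TL: by monotonicity such a deficit would persist on an interval to the left of T and make the
sum too small. -/

noncomputable section

/-! ### Entire functions: factoring out zeros, and bounds in terms of them. -/

section EntireFunctions

theorem analyticOrderAt_ne_top_of_entire {F : ℂ → ℂ} (hF : Differentiable ℂ F) {w₀ : ℂ}
    (h₀ : F w₀ ≠ 0) (u : ℂ) : analyticOrderAt F u ≠ ⊤ := by
  have hA : AnalyticOnNhd ℂ F Set.univ := fun z _ => hF.analyticAt z
  refine hA.analyticOrderAt_ne_top_of_isPreconnected isPreconnected_univ (Set.mem_univ w₀)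
    (Set.mem_univ u) ?_
  rw [(hF.analyticAt w₀).analyticOrderAt_eq_zero.mpr h₀]
  simp

theorem exists_entire_eq_pow_mul {F : ℂ → ℂ} (hF : Differentiable ℂ F) {w₀ : ℂ}
    (h₀ : F w₀ ≠ 0) (u : ℂ) :
    ∃ H : ℂ → ℂ, Differentiable ℂ H ∧ H u ≠ 0 ∧
      ∀ w, F w = (w - u) ^ analyticOrderNatAt F u * H w := by
  set n := analyticOrderNatAt F u with hn
  have hn' : analyticOrderAt F u = n :=
    (Nat.cast_analyticOrderNatAt (analyticOrderAt_ne_top_of_entire hF h₀ u)).symm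
  obtain ⟨g, hg, hgu, hFg⟩ := (hF.analyticAt u).analyticOrderAt_eq_natCast.mp hn'
  classical
  let H : ℂ → ℂ := fun w => if w = u then g u else F w / (w - u) ^ n
  have hHg : H =ᶠ[𝓝 u] g := by
    filter_upwards [hFg] with w hw
    by_cases h : w = u
    · simp [H, h]
    · have : w - u ≠ 0 := sub_ne_zero.mpr h
      simp only [H, h, if_false, hw, smul_eq_mul]
      field_simp
  refine ⟨H, fun w => ?_, by simpa [H] using hgu, fun w => ?_⟩
  · by_cases h : w = u
    · subst h
      exact hg.differentiableAt.congr_of_eventuallyEq hHg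
    · have h1 : (fun w => F w / (w - u) ^ n) =ᶠ[𝓝 w] H := by
        filter_upwards [isOpen_ne.mem_nhds h] with z hz
        have hz' : z ≠ u := hz
        simp [H, hz']
      refine DifferentiableAt.congr_of_eventuallyEq ?_ h1.symm
      have : (w - u) ^ n ≠ 0 := pow_ne_zero _ (sub_ne_zero.mpr h)
      exact (hF w).div (by fun_prop) this
  · by_cases h : w = u
    · subst h
      have := hFg.self_of_nhds
      simpa [H] using this
    · have : (w - u) ^ n ≠ 0 := pow_ne_zero _ (sub_ne_zero.mpr h)
      simp only [H, h, if_false]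
      field_simp

theorem exists_entire_eq_prod_mul {F : ℂ → ℂ} (hF : Differentiable ℂ F) {w₀ : ℂ}
    (h₀ : F w₀ ≠ 0) (Z : Finset ℂ) :
    ∃ H : ℂ → ℂ, Differentiable ℂ H ∧ (∀ u ∈ Z, H u ≠ 0) ∧
      ∀ w, F w = (∏ u ∈ Z, (w - u) ^ analyticOrderNatAt F u) * H w := by
  classical
  induction Z using Finset.induction_on with
  | empty => exact ⟨F, hF, by simp, by simp⟩
  | insert u Z hu ih =>
    obtain ⟨H, hH, hHZ, hFH⟩ := ih
    have hH₀ : H w₀ ≠ 0 := fun h => h₀ (by rw [hFH, h, mul_zero])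
    obtain ⟨K, hK, hKu, hHK⟩ := exists_entire_eq_pow_mul hH hH₀ u
    -- The factors already removed do not vanish at the new point, so the order there is unchanged.
    have hord : analyticOrderNatAt F u = analyticOrderNatAt H u := by
      have hP : Differentiable ℂ (fun w => ∏ v ∈ Z, (w - v) ^ analyticOrderNatAt F v) := by
        fun_prop
      have hPu : (∏ v ∈ Z, (u - v) ^ analyticOrderNatAt F v) ≠ 0 :=
        Finset.prod_ne_zero_iff.mpr fun v hv =>
          pow_ne_zero _ (sub_ne_zero.mpr fun h => hu (h ▸ hv))
      have hFe : F = (fun w => ∏ v ∈ Z, (w - v) ^ analyticOrderNatAt F v) * H := funext hFH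
      have h1 := congrArg (fun f => analyticOrderAt f u) hFe
      simp only [analyticOrderAt_mul (hP.analyticAt u) (hH.analyticAt u),
        (hP.analyticAt u).analyticOrderAt_eq_zero.mpr hPu, zero_add] at h1
      rw [analyticOrderNatAt, h1, analyticOrderNatAt]
    refine ⟨K, hK, ?_, fun w => ?_⟩
    · intro v hv
      rcases Finset.mem_insert.mp hv with rfl | hv
      · exact hKu
      · intro h
        exact hHZ v hv (by rw [hHK, h, mul_zero])
    · rw [Finset.prod_insert hu, hFH w, hHK w, hord]
      ring

/-- A primitive g of H'/H with g(c) = 0 satisfies H = H(c) exp g, so the growth bound reads Re g ≤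
A, and Borel–Carathéodory bounds |g|. -/
theorem norm_le_exp_of_ne_zero_on_ball {H : ℂ → ℂ} {c : ℂ} {R A : ℝ} (hR : 0 < R) (hA : 0 < A)
    (hH : Differentiable ℂ H) (hne : ∀ w ∈ Metric.ball c R, H w ≠ 0)
    (hbd : ∀ w ∈ Metric.ball c R, ‖H w‖ ≤ ‖H c‖ * Real.exp A) {w : ℂ} (hw : w ∈ Metric.ball c R) :
    ‖H w‖ ≤ ‖H c‖ * Real.exp (2 * A * ‖w - c‖ / (R - ‖w - c‖)) := by
  have hc : c ∈ Metric.ball c R := Metric.mem_ball_self hR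
  have hdiff : DifferentiableOn ℂ (fun z => deriv H z / H z) (Metric.ball c R) := by
    intro z hz
    exact (((hH.deriv z).div (hH z) (hne z hz))).differentiableWithinAt
  obtain ⟨g, hgc, hg⟩ := hdiff.isExactOn_ball.with_val_at c 0
  have key : ∀ z ∈ Metric.ball c R, H z = H c * Complex.exp (g z) := by
    have hconst : ∀ z ∈ Metric.ball c R, H z * Complex.exp (-g z) = H c * Complex.exp (-g c) := by
      intro z hz
      refine (convex_ball c R).is_const_of_fderivWithin_eq_zero (𝕜 := ℂ)
        (f := fun z => H z * Complex.exp (-g z)) ?_ ?_ hz hc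
      · intro y hy
        exact ((hH y).mul ((hg y hy).differentiableAt.neg.cexp)).differentiableWithinAt
      · intro y hy
        rw [fderivWithin_of_isOpen Metric.isOpen_ball hy]
        have h1 : HasDerivAt (fun z => H z * Complex.exp (-g z))
            (deriv H y * Complex.exp (-g y) +
              H y * (Complex.exp (-g y) * -(deriv H y / H y))) y :=
          (hH y).hasDerivAt.mul ((hg y hy).neg.cexp)
        have h2 : deriv H y * Complex.exp (-g y) +
              H y * (Complex.exp (-g y) * -(deriv H y / H y)) = 0 := by
          field_simp [hne y hy]
          ring
        rw [h2] at h1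
        have := h1.hasFDerivAt.fderiv
        rw [this]
        ext
        simp
    intro z hz
    have h1 := hconst z hz
    rw [hgc, neg_zero, Complex.exp_zero, mul_one] at h1
    rw [← h1, mul_assoc, ← Complex.exp_add]
    simp
  have hHc : 0 < ‖H c‖ := norm_pos_iff.mpr (hne c hc)
  have hre : ∀ z ∈ Metric.ball c R, (g z).re ≤ A := by
    intro z hz
    have h1 := hbd z hz
    rw [key z hz, norm_mul, Complex.norm_exp] at h1
    exact Real.exp_le_exp.mp (le_of_mul_le_mul_left h1 hHc)
  have hmap : ∀ z ∈ Metric.ball (0 : ℂ) R, z + c ∈ Metric.ball c R := by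
    intro z hz
    simpa [Metric.mem_ball, dist_eq_norm] using hz
  have hBC := Complex.borelCaratheodory_zero (f := fun z => g (z + c)) (M := A) (R := R)
    (z := w - c) hA
    (fun z hz => ((hg _ (hmap z hz)).differentiableAt.comp z
      (by fun_prop : DifferentiableAt ℂ (fun z => z + c) z)).differentiableWithinAt)
    (fun z hz => hre _ (hmap z hz)) hR
    (by simpa [Metric.mem_ball, dist_eq_norm] using hw) (by simpa using hgc)
  rw [key w hw, norm_mul, Complex.norm_exp]
  gcongr
  simp only [sub_add_cancel] at hBC
  exact (Complex.re_le_norm _).trans hBC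

/-- An entire function of controlled growth is dominated by the product over its zeros in a disc. -/
theorem norm_le_prod_zeros {F : ℂ → ℂ} (hF : Differentiable ℂ F) {c : ℂ} (hc : F c ≠ 0)
    {R A : ℝ} (hR : 0 < R) (hA : 0 < A) (Z : Finset ℂ)
    (hZ : ∀ u, u ∈ Z ↔ u ∈ Metric.closedBall c R ∧ F u = 0)
    (hbd : ∀ w ∈ Metric.sphere c (3 * R), ‖F w‖ ≤ ‖F c‖ * Real.exp A) {w : ℂ}
    (hw : w ∈ Metric.ball c R) :
    ‖F w‖ ≤ ‖F c‖ * (∏ u ∈ Z, (‖w - u‖ / ‖c - u‖) ^ analyticOrderNatAt F u) *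
      Real.exp (2 * A * ‖w - c‖ / (R - ‖w - c‖)) := by
  obtain ⟨H, hH, hHZ, hFH⟩ := exists_entire_eq_prod_mul hF hc Z
  have hcu : ∀ u ∈ Z, 0 < ‖c - u‖ := by
    intro u hu
    refine norm_pos_iff.mpr (sub_ne_zero.mpr ?_)
    rintro rfl
    exact hc ((hZ _).mp hu).2
  set P : ℂ → ℝ := fun w => ∏ u ∈ Z, ‖w - u‖ ^ analyticOrderNatAt F u with hP
  have hPc : 0 < P c := Finset.prod_pos fun u hu => pow_pos (hcu u hu) _
  have hnorm : ∀ w, ‖F w‖ = P w * ‖H w‖ := by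
    intro w
    rw [hFH w, norm_mul, norm_prod]
    simp [hP, norm_pow]
  have hsphere : ∀ w ∈ Metric.sphere c (3 * R), ‖H w‖ ≤ ‖H c‖ * Real.exp A := by
    intro w hw
    -- On the sphere of radius 3R every zero u is at distance at least 2R from w and at most R from
    -- c. The growth bound for F therefore passes to H, and the maximum principle carries it inside.
    have hPw : P c ≤ P w := by
      refine Finset.prod_le_prod (fun u _ => by positivity) fun u hu => ?_
      gcongr
      have h1 : ‖u - c‖ ≤ R := by simpa [dist_eq_norm] using ((hZ u).mp hu).1
      have h2 : ‖w - c‖ = 3 * R := by simpa [dist_eq_norm] using hw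
      have h3 : ‖w - c‖ ≤ ‖w - u‖ + ‖u - c‖ := norm_sub_le_norm_sub_add_norm_sub _ _ _
      rw [norm_sub_rev c u]
      linarith
    have h1 := hbd w hw
    rw [hnorm w, hnorm c] at h1
    have h2 : P c * ‖H w‖ ≤ P c * (‖H c‖ * Real.exp A) := by
      calc P c * ‖H w‖ ≤ P w * ‖H w‖ := by gcongr
        _ ≤ P c * ‖H c‖ * Real.exp A := h1
        _ = _ := by ring
    exact le_of_mul_le_mul_left h2 hPc
  have hball : ∀ w ∈ Metric.ball c R, ‖H w‖ ≤ ‖H c‖ * Real.exp A := by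
    intro w hw
    have h3R : (3 * R) ≠ 0 := by positivity
    refine Complex.norm_le_of_forall_mem_frontier_norm_le (U := Metric.ball c (3 * R))
      Metric.isBounded_ball hH.diffContOnCl ?_ (subset_closure ?_)
    · rw [frontier_ball c h3R]
      exact hsphere
    · exact Metric.ball_subset_ball (by linarith) hw
  have hne : ∀ w ∈ Metric.ball c R, H w ≠ 0 := by
    intro w hw h
    have hwZ : w ∈ Z := (hZ w).mpr ⟨Metric.ball_subset_closedBall hw, by rw [hFH, h, mul_zero]⟩
    exact hHZ w hwZ h
  have h1 := norm_le_exp_of_ne_zero_on_ball hR hA hH hne hball hw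
  have hprod : ∏ u ∈ Z, (‖w - u‖ / ‖c - u‖) ^ analyticOrderNatAt F u = P w / P c := by
    simp [hP, div_pow, Finset.prod_div_distrib]
  have hPw : 0 ≤ P w := Finset.prod_nonneg fun u _ => by positivity
  rw [hprod, hnorm w, hnorm c]
  calc P w * ‖H w‖ ≤ P w * (‖H c‖ * Real.exp (2 * A * ‖w - c‖ / (R - ‖w - c‖))) := by gcongr
    _ = _ := by field_simp

/-- An even entire function is an entire function of the square of the variable. -/
theorem exists_entire_comp_sq {f : ℂ → ℂ} (hf : Differentiable ℂ f) (heven : ∀ z, f (-z) = f z) :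
    ∃ F : ℂ → ℂ, Differentiable ℂ F ∧ ∀ z, F (z ^ 2) = f z := by
  let r : ℂ → ℂ := fun w => w ^ ((1 : ℂ) / 2)
  have hr : ∀ w, r w ^ 2 = w := fun w => by
    simp only [r, one_div]
    exact_mod_cast Complex.cpow_nat_inv_pow w two_ne_zero
  have hFsq : ∀ z w, z ^ 2 = w → f (r w) = f z := by
    intro z w h
    have : (r w - z) * (r w + z) = 0 := by
      have := hr w
      linear_combination this - h
    rcases mul_eq_zero.mp this with h | h
    · rw [sub_eq_zero.mp h]
    · rw [eq_neg_of_add_eq_zero_left h, heven]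
  have hne : ∀ w, w ≠ 0 → DifferentiableAt ℂ (fun w => f (r w)) w := by
    intro w hw
    -- The principal root may be cut at w. By evenness any root gives the same value, so a branch
    -- holomorphic near w is used.
    have h1 : (fun w => f (r w)) = fun v => f (r w * (v / w) ^ ((1 : ℂ) / 2)) := by
      funext v
      refine hFsq _ _ ?_
      have h2 := hr (v / w)
      have h3 := hr w
      simp only [r] at h2 h3
      rw [mul_pow, h2, h3]
      field_simp
    rw [h1]
    refine (hf _).comp w (DifferentiableAt.const_mul ?_ _)
    refine DifferentiableAt.cpow_const (by fun_prop) ?_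
    rw [div_self hw]
    exact Complex.one_mem_slitPlane
  have hcont : ContinuousAt (fun w => f (r w)) 0 := by
    have hr0 : r 0 = 0 := by simp [r]
    have : ContinuousAt r 0 := by
      rw [ContinuousAt, hr0, tendsto_zero_iff_norm_tendsto_zero]
      have h1 : ∀ w, ‖r w‖ = Real.sqrt ‖w‖ := by
        intro w
        rw [← hr w, norm_pow, Real.sqrt_sq (norm_nonneg _), hr w]
      simp_rw [h1]
      have : Continuous fun w : ℂ => Real.sqrt ‖w‖ := by fun_prop
      simpa using this.tendsto 0
    exact ContinuousAt.comp (f := r) (hf _).continuousAt this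
  refine ⟨fun w => f (r w), fun w => ?_, fun z => hFsq z _ rfl⟩
  by_cases hw : w = 0
  · subst hw
    refine (Complex.analyticAt_of_differentiable_on_punctured_nhds_of_continuousAt ?_
      hcont).differentiableAt
    filter_upwards [self_mem_nhdsWithin] with v hv
    exact hne v hv
  · exact hne w hw

end EntireFunctions

/-! ### Growth of the completed zeta-function through its Mellin transform. -/

section CompletedZetaGrowth

open HurwitzZeta MeasureTheory Asymptotics

/-- Apply log y ≤ y - 1 at y = ax/σ. -/
theorem rpow_le_exp_mul_rpow {x σ a : ℝ} (hx : 0 < x) (hσ : 0 < σ) (ha : 0 < a) :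
    x ^ σ ≤ Real.exp (a * x) * (σ / a) ^ σ := by
  rw [Real.rpow_def_of_pos hx, Real.rpow_def_of_pos (div_pos hσ ha), ← Real.exp_add]
  refine Real.exp_le_exp.mpr ?_
  have h1 := Real.log_le_sub_one_of_pos (show 0 < x * (a / σ) by positivity)
  rw [Real.log_mul hx.ne' (by positivity), ← inv_div σ a, Real.log_inv] at h1
  have h2 : σ * (x * (σ / a)⁻¹) = a * x := by field_simp
  nlinarith

/-- The modified theta kernel decays like exp(-px). Half of this decay dominates the power of x in
the Mellin integrand, uniformly in s; the other half keeps the remaining integral finite. -/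
theorem exists_norm_completedRiemannZeta₀_le :
    ∃ K p : ℝ, 0 < K ∧ 0 < p ∧ ∀ s : ℂ, 0 < s.re →
      ‖completedRiemannZeta₀ s‖ ≤ K * (s.re / p) ^ (s.re / 2) := by
  obtain ⟨p, hp, hO⟩ := isBigO_atTop_evenKernel_sub 0
  set P := hurwitzEvenFEPair 0 with hP
  set g : ℝ → ℂ := P.f_modif with hg
  have hgtop : g =O[atTop] fun x => Real.exp (-p * x) := by
    have h1 : (fun x => ((evenKernel 0 x - 1 : ℝ) : ℂ)) =O[atTop] fun x => Real.exp (-p * x) := by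
      refine IsBigO.trans ?_ (by simpa using hO)
      exact isBigO_of_le _ fun x => by rw [Complex.norm_real]
    refine h1.congr' ?_ EventuallyEq.rfl
    filter_upwards [eventually_gt_atTop 1] with x hx
    simp [hg, hP, WeakFEPair.f_modif, Set.mem_Ioi.mpr hx, Set.notMem_Ioo_of_ge hx.le,
      hurwitzEvenFEPair]
  have hstrong := P.isStrongFEPair_toStrongFEPair
  have hg0 : g =O[𝓝[>] 0] fun x => x ^ (1 : ℝ) := hstrong.hf_zero 1
  let h : ℝ → ℂ := fun x => (Real.exp (p / 2 * x) : ℂ) * g x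
  have hhloc : LocallyIntegrableOn h (Set.Ioi 0) := by
    refine P.hf_modif_int.continuousOn_mul ?_ isOpen_Ioi.isLocallyClosed
    fun_prop
  have hhtop : h =O[atTop] fun x => x ^ (-(1 : ℝ)) := by
    have h1 : h =O[atTop] fun x => Real.exp (-(p / 2) * x) := by
      have h2 : (fun x : ℝ => (Real.exp (p / 2 * x) : ℂ)) =O[atTop]
          fun x => Real.exp (p / 2 * x) :=
        isBigO_of_le _ fun x => by rw [Complex.norm_real]
      refine (h2.mul hgtop).congr_right fun x => ?_
      rw [← Real.exp_add]
      ring_nf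
    exact h1.trans (isLittleO_exp_neg_mul_rpow_atTop (by positivity) _).isBigO
  have hh0 : h =O[𝓝[>] 0] fun x => x ^ (-(-1 : ℝ)) := by
    have h2 : (fun x : ℝ => (Real.exp (p / 2 * x) : ℂ)) =O[𝓝[>] 0] fun _ => (1 : ℝ) := by
      refine Tendsto.isBigO_one (c := ((Real.exp (p / 2 * 0) : ℝ) : ℂ)) ℝ ?_
      refine Tendsto.mono_left ?_ nhdsWithin_le_nhds
      exact Continuous.tendsto (f := fun x : ℝ => (Real.exp (p / 2 * x) : ℂ)) (by fun_prop) 0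
    exact (h2.mul hg0).congr_right fun x => by simp
  have hconv : MellinConvergent h 0 :=
    mellinConvergent_of_isBigO_rpow hhloc hhtop (by simp) hh0 (by simp)
  have hInt : IntegrableOn (fun x : ℝ => x⁻¹ * (Real.exp (p / 2 * x) * ‖g x‖)) (Set.Ioi 0) := by
    refine IntegrableOn.congr_fun (Integrable.norm hconv) (fun x hx => ?_) measurableSet_Ioi
    have hx' : (0 : ℝ) < x := hx
    simp only [h, norm_smul, norm_mul, Complex.norm_real, Real.norm_eq_abs, Real.abs_exp]
    rw [Complex.norm_cpow_eq_rpow_re_of_pos hx']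
    simp [Real.rpow_neg_one]
  set K₀ := ∫ x in Set.Ioi (0 : ℝ), x⁻¹ * (Real.exp (p / 2 * x) * ‖g x‖) with hK₀
  have hK₀nn : 0 ≤ K₀ := by
    refine setIntegral_nonneg measurableSet_Ioi fun x hx => ?_
    have hx' : (0 : ℝ) < x := hx
    positivity
  refine ⟨K₀ + 1, p, by positivity, hp, fun s hs => ?_⟩
  have h1 : completedRiemannZeta₀ s = mellin g (s / 2) / 2 := rfl
  have hre : (s / 2).re = s.re / 2 := by simp
  have h2 : ‖mellin g (s / 2)‖ ≤ (s.re / p) ^ (s.re / 2) * K₀ := by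
    rw [hK₀, ← integral_const_mul, mellin]
    refine norm_integral_le_of_norm_le (hInt.const_mul _) ?_
    filter_upwards [ae_restrict_mem measurableSet_Ioi] with x hx
    have hx' : (0 : ℝ) < x := hx
    rw [norm_smul, Complex.norm_cpow_eq_rpow_re_of_pos hx', Complex.sub_re, hre, Complex.one_re,
      Real.rpow_sub_one hx'.ne']
    have h3 := rpow_le_exp_mul_rpow (σ := s.re / 2) (a := p / 2) hx' (by positivity) (by positivity)
    have h4 : s.re / 2 / (p / 2) = s.re / p := by field_simp
    rw [h4] at h3
    calc x ^ (s.re / 2) / x * ‖g x‖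
        ≤ Real.exp (p / 2 * x) * (s.re / p) ^ (s.re / 2) / x * ‖g x‖ := by gcongr
      _ = _ := by field_simp
  rw [h1, norm_div, Complex.norm_ofNat]
  have h5 : 0 ≤ (s.re / p) ^ (s.re / 2) := by positivity
  have h6 := norm_nonneg (mellin g (s / 2))
  nlinarith

end CompletedZetaGrowth

/-! ### The function ξ: growth, zeros, symmetries and size on the real axis. -/

section CompletedZeta

open ZetaPairs

/-- Twice Riemann's entire function `ξ`, centred at the point `1 / 2`. -/
def xiEven (z : ℂ) : ℂ := 1 + (z ^ 2 - 1 / 4) * completedRiemannZeta₀ (1 / 2 + z)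

theorem differentiable_xiEven : Differentiable ℂ xiEven := by
  unfold xiEven
  have := differentiable_completedZeta₀
  fun_prop

theorem xiEven_neg (z : ℂ) : xiEven (-z) = xiEven z := by
  rw [xiEven, xiEven, ← completedRiemannZeta₀_one_sub (1 / 2 + z)]
  ring_nf

theorem xiEven_eq {z : ℂ} (h0 : 1 / 2 + z ≠ 0) (h1 : 1 / 2 + z ≠ 1) :
    xiEven z = (z ^ 2 - 1 / 4) * completedRiemannZeta (1 / 2 + z) := by
  have h2 : 1 - (1 / 2 + z) ≠ 0 := sub_ne_zero.mpr h1.symm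
  have key : ∀ s Λ : ℂ, s ≠ 0 → 1 - s ≠ 0 →
      1 + -(s * (1 - s)) * Λ = -(s * (1 - s)) * (Λ - 1 / s - 1 / (1 - s)) := by
    intro s Λ hs hs'
    field_simp
    ring
  have : z ^ 2 - 1 / 4 = -((1 / 2 + z) * (1 - (1 / 2 + z))) := by ring
  rw [xiEven, completedRiemannZeta_eq, this, key _ _ h0 h2]

theorem sub_mul_self_eq (z : ℂ) : z ^ 2 - 1 / 4 = (1 / 2 + z) * ((1 / 2 + z) - 1) := by ring

/-- The bound obtained is of size |z| log|z|; the logarithm is absorbed in a square root. Any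
exponent below 2 makes ξ of order less than 1 in the variable z², so no exponential factor is needed
in its product. -/
theorem exists_norm_xiEven_le :
    ∃ C : ℝ, 0 < C ∧ ∀ z : ℂ, ‖xiEven z‖ ≤ Real.exp (C * (1 + ‖z‖) ^ (3 / 2 : ℝ)) := by
  obtain ⟨K, p, hK, hp, hb⟩ := exists_norm_completedRiemannZeta₀_le
  set c := 2 + |Real.log p| with hc
  have hc0 : 0 < c := by positivity
  refine ⟨K + 2 + c, by positivity, ?_⟩
  have main : ∀ z : ℂ, 0 ≤ z.re →
      ‖xiEven z‖ ≤ Real.exp ((K + 2 + c) * (1 + ‖z‖) ^ (3 / 2 : ℝ)) := by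
    intro z hz
    set y := 1 + ‖z‖ with hy
    have hy1 : 1 ≤ y := by simp [hy]
    have hy32 : y ^ (3 / 2 : ℝ) = y * Real.sqrt y := by
      rw [Real.sqrt_eq_rpow, show (3 / 2 : ℝ) = 1 + 1 / 2 by norm_num,
        Real.rpow_add (by positivity), Real.rpow_one]
    have hsq1 : 1 ≤ Real.sqrt y := Real.one_le_sqrt.mpr hy1
    set σ := (1 / 2 + z).re with hσ
    have hσeq : σ = 1 / 2 + z.re := by simp [hσ]
    have hσ0 : 0 < σ := by rw [hσeq]; positivity
    have hσy : σ ≤ y := by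
      have := Complex.re_le_norm z
      rw [hσeq, hy]; linarith
    have h1 := hb (1 / 2 + z) hσ0
    have h2 : (σ / p) ^ (σ / 2) ≤ Real.exp (c * y ^ (3 / 2 : ℝ)) := by
      rw [Real.rpow_def_of_pos (by positivity)]
      refine Real.exp_le_exp.mpr ?_
      have h3 : Real.log (σ / p) ≤ c * Real.sqrt y := by
        rw [Real.log_div hσ0.ne' hp.ne']
        have h4 : Real.log σ ≤ Real.log y := Real.log_le_log hσ0 hσy
        have h5 : Real.log y ≤ 2 * Real.sqrt y := by
          have h6 := Real.log_le_sub_one_of_pos (show 0 < Real.sqrt y by positivity)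
          rw [Real.log_sqrt (by positivity)] at h6
          linarith
        have h7 := neg_abs_le (Real.log p)
        have h8 := abs_nonneg (Real.log p)
        rw [hc]
        nlinarith
      calc Real.log (σ / p) * (σ / 2) ≤ c * Real.sqrt y * (σ / 2) := by gcongr
        _ ≤ c * Real.sqrt y * y := by gcongr; linarith
        _ = _ := by rw [hy32]; ring
    have h9 : ‖xiEven z‖ ≤ 1 + y ^ 2 * (K * Real.exp (c * y ^ (3 / 2 : ℝ))) := by
      refine (norm_add_le _ _).trans ?_
      rw [norm_one, norm_mul]
      gcongr
      · refine (norm_sub_le _ _).trans ?_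
        rw [norm_pow, hy]
        norm_num
        nlinarith [norm_nonneg z]
      · exact h1.trans (by gcongr)
    have hE : 1 ≤ Real.exp (c * y ^ (3 / 2 : ℝ)) := Real.one_le_exp (by positivity)
    have hyy : y ≤ y ^ (3 / 2 : ℝ) := by rw [hy32]; nlinarith
    have hy32' : 1 ≤ y ^ (3 / 2 : ℝ) := hy1.trans hyy
    calc ‖xiEven z‖ ≤ 1 + y ^ 2 * (K * Real.exp (c * y ^ (3 / 2 : ℝ))) := h9
      _ ≤ (1 + K) * y ^ 2 * Real.exp (c * y ^ (3 / 2 : ℝ)) := by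
          have : 1 ≤ y ^ 2 * Real.exp (c * y ^ (3 / 2 : ℝ)) := by nlinarith
          nlinarith
      _ ≤ Real.exp K * Real.exp y ^ 2 * Real.exp (c * y ^ (3 / 2 : ℝ)) := by
          have h10 := Real.add_one_le_exp K
          have h11 := Real.add_one_le_exp y
          gcongr <;> linarith
      _ = Real.exp (K + 2 * y + c * y ^ (3 / 2 : ℝ)) := by
          rw [← Real.exp_nat_mul, Real.exp_add, Real.exp_add]; norm_num
      _ ≤ _ := Real.exp_le_exp.mpr (by nlinarith)
  intro z
  rcases le_total 0 z.re with h | h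
  · exact main z h
  · have := main (-z) (by simpa using h)
    rwa [xiEven_neg, norm_neg] at this

theorem xiEven_eq_zeta {z : ℂ} (h : 0 < (1 / 2 + z).re) (h1 : 1 / 2 + z ≠ 1) :
    xiEven z = (1 / 2 + z) * ((1 / 2 + z) - 1) * Complex.Gammaℝ (1 / 2 + z) *
      riemannZeta (1 / 2 + z) := by
  have h0 : 1 / 2 + z ≠ 0 := by
    intro h0
    rw [h0] at h
    simp at h
  have hG := Complex.Gammaℝ_ne_zero_of_re_pos h
  rw [xiEven_eq h0 h1, riemannZeta_def_of_ne_zero h0, sub_mul_self_eq,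
    mul_assoc _ (Complex.Gammaℝ _), mul_div_cancel₀ _ hG]

theorem xiEven_ne_zero_of_half_le_re {z : ℂ} (h : 1 / 2 ≤ z.re) : xiEven z ≠ 0 := by
  by_cases h1 : 1 / 2 + z = 1
  · have : z = 1 / 2 := by linear_combination h1
    rw [this, xiEven]
    norm_num
  · have hre : 1 ≤ (1 / 2 + z).re := by simp; linarith
    have h0 : 1 / 2 + z ≠ 0 := by
      intro h0
      rw [h0] at hre
      norm_num at hre
    rw [xiEven_eq_zeta (by linarith) h1]
    exact mul_ne_zero (mul_ne_zero (mul_ne_zero h0 (sub_ne_zero.mpr h1))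
      (Complex.Gammaℝ_ne_zero_of_re_pos (by linarith))) (riemannZeta_ne_zero_of_one_le_re hre)

theorem abs_re_lt_of_xiEven_eq_zero {z : ℂ} (h : xiEven z = 0) : |z.re| < 1 / 2 := by
  rw [abs_lt]
  constructor
  · by_contra! hc
    refine xiEven_ne_zero_of_half_le_re (z := -z) ?_ (by rwa [xiEven_neg])
    simp; linarith
  · by_contra! hc
    exact xiEven_ne_zero_of_half_le_re hc h

theorem mem_nontrivialZeros_of_xiEven_eq_zero {z : ℂ} (h : xiEven z = 0) :
    1 / 2 + z ∈ nontrivialZeros := by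
  obtain ⟨h2, h3⟩ := abs_lt.mp (abs_re_lt_of_xiEven_eq_zero h)
  have hre : (1 / 2 + z).re = 1 / 2 + z.re := by simp
  have hpos : 0 < (1 / 2 + z).re := by linarith
  have h1 : 1 / 2 + z ≠ 1 := by
    intro h1
    rw [h1] at hre
    norm_num at hre
    linarith
  have h0 : 1 / 2 + z ≠ 0 := by
    intro h0
    rw [h0] at hpos
    simp at hpos
  refine ⟨?_, hpos, by linarith⟩
  rw [xiEven_eq_zeta hpos h1] at h
  exact (mul_eq_zero.mp h).resolve_left (mul_ne_zero (mul_ne_zero h0 (sub_ne_zero.mpr h1))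
      (Complex.Gammaℝ_ne_zero_of_re_pos hpos))

theorem analyticOrderAt_xiEven {z : ℂ} (h : |z.re| < 1 / 2) :
    analyticOrderAt xiEven z = analyticOrderAt riemannZeta (1 / 2 + z) := by
  obtain ⟨h2, h3⟩ := abs_lt.mp h
  have hre : (1 / 2 + z).re = 1 / 2 + z.re := by simp
  have hpos : 0 < (1 / 2 + z).re := by linarith
  have h1 : 1 / 2 + z ≠ 1 := by
    intro h1
    rw [h1] at hre
    norm_num at hre
    linarith
  have h0 : 1 / 2 + z ≠ 0 := by
    intro h0
    rw [h0] at hpos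
    simp at hpos
  have hshift : AnalyticAt ℂ (fun w : ℂ => 1 / 2 + w) z := by fun_prop
  have hζ : AnalyticAt ℂ riemannZeta (1 / 2 + z) := analyticOn_riemannZeta _ h1
  have hG : Differentiable ℂ (fun w : ℂ => (Complex.Gammaℝ (1 / 2 + w))⁻¹) :=
    Complex.differentiable_Gammaℝ_inv.comp (by fun_prop)
  have hp : Differentiable ℂ (fun w : ℂ => (1 / 2 + w) * ((1 / 2 + w) - 1)) := by fun_prop
  -- The reciprocal Gamma factor is entire and nonzero here, so it does not affect the order.
  have heq : xiEven * (fun w : ℂ => (Complex.Gammaℝ (1 / 2 + w))⁻¹) =ᶠ[𝓝 z]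
      (fun w : ℂ => (1 / 2 + w) * ((1 / 2 + w) - 1)) * (riemannZeta ∘ fun w => 1 / 2 + w) := by
    have hc : Continuous fun w : ℂ => 1 / 2 + w := by fun_prop
    have hc' : Continuous fun w : ℂ => (1 / 2 + w).re := by fun_prop
    filter_upwards [(isOpen_lt continuous_const hc').mem_nhds hpos,
      (isOpen_ne.preimage hc).mem_nhds h1] with w hw hw1
    have hGw := Complex.Gammaℝ_ne_zero_of_re_pos hw
    simp only [Pi.mul_apply, Function.comp_apply]
    rw [xiEven_eq_zeta hw hw1, mul_right_comm _ (riemannZeta _), mul_inv_cancel_right₀ hGw]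
  have hord := analyticOrderAt_congr heq
  rw [analyticOrderAt_mul (differentiable_xiEven.analyticAt z) (hG.analyticAt z),
    analyticOrderAt_mul (hp.analyticAt z) (hζ.comp hshift),
    (hG.analyticAt z).analyticOrderAt_eq_zero.mpr
      (inv_ne_zero (Complex.Gammaℝ_ne_zero_of_re_pos hpos)),
    (hp.analyticAt z).analyticOrderAt_eq_zero.mpr (mul_ne_zero h0 (sub_ne_zero.mpr h1)),
    analyticOrderAt_comp_of_deriv_ne_zero hshift (by simp)] at hord
  simpa using hord

theorem one_sub_mem_nontrivialZeros {ρ : ℂ} (h : ρ ∈ nontrivialZeros) :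
    1 - ρ ∈ nontrivialZeros := by
  obtain ⟨h0, h1, h2⟩ := h
  have hre : (1 / 2 + (ρ - 1 / 2)).re = ρ.re := by simp
  have hx : xiEven (ρ - 1 / 2) = 0 := by
    have h3 : (1 : ℂ) / 2 + (ρ - 1 / 2) = ρ := by ring
    rw [xiEven_eq_zeta (by rw [hre]; exact h1), h3, h0, mul_zero]
    rw [h3]
    rintro rfl
    simp at h2
  rw [← xiEven_neg] at hx
  have := mem_nontrivialZeros_of_xiEven_eq_zero hx
  ring_nf at this ⊢
  exact this

/-- This reflection keeps the ordinate, so a zero off the line yields an extra pair with difference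
0. -/
theorem one_sub_conj_mem_nontrivialZeros {ρ : ℂ} (h : ρ ∈ nontrivialZeros) :
    1 - (starRingEnd ℂ) ρ ∈ nontrivialZeros := by
  refine one_sub_mem_nontrivialZeros ⟨?_, by simpa using h.2.1, by simpa using h.2.2⟩
  rw [riemannZeta_conj, h.1, map_zero]

theorem one_le_mult {ρ : ℂ} (h : ρ ∈ nontrivialZeros) : 1 ≤ mult ρ := by
  obtain ⟨h0, h1, h2⟩ := h
  have hρ : ρ ≠ 1 := by
    rintro rfl
    simp at h2
  have hζ : AnalyticAt ℂ riemannZeta ρ := analyticOn_riemannZeta _ hρ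
  have hz : |(ρ - 1 / 2).re| < 1 / 2 := by
    rw [abs_lt]; simp; constructor <;> linarith
  have h4 := analyticOrderAt_xiEven hz
  rw [show (1 : ℂ) / 2 + (ρ - 1 / 2) = ρ by ring] at h4
  -- `analyticOrderNatAt` would be 0 at infinite order, so that case must be excluded.
  have htop : analyticOrderAt riemannZeta ρ ≠ ⊤ := by
    rw [← h4]
    exact analyticOrderAt_ne_top_of_entire differentiable_xiEven
      (xiEven_ne_zero_of_half_le_re (z := 1) (by norm_num)) _
  have hne : analyticOrderAt riemannZeta ρ ≠ 0 := by
    rw [Ne, hζ.analyticOrderAt_eq_zero]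
    simpa using h0
  rw [Nat.one_le_iff_ne_zero, mult]
  intro h5
  apply hne
  rw [← Nat.cast_analyticOrderNatAt htop, h5]
  rfl

theorem one_le_norm_riemannZeta_even (n : ℕ) : 1 ≤ ‖riemannZeta (2 * n + 2 : ℂ)‖ := by
  have h1 : (1 : ℕ) < 2 * n + 2 := by omega
  have h2 := zeta_nat_eq_tsum_of_gt_one h1
  have h3 : riemannZeta (2 * n + 2 : ℂ) = ((∑' k : ℕ, 1 / (k : ℝ) ^ (2 * n + 2) : ℝ) : ℂ) := by
    push_cast at h2 ⊢
    exact h2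
  rw [h3, Complex.norm_real, Real.norm_eq_abs]
  refine le_trans ?_ (le_abs_self _)
  have hs : Summable fun k : ℕ => 1 / (k : ℝ) ^ (2 * n + 2) :=
    Real.summable_one_div_nat_pow.mpr h1
  have := hs.le_tsum 1 (fun k _ => by positivity)
  simpa using this

/-- Here s = 2n + 2, where the Gamma factor is n!/π^(n+1); the other factors s, s - 1 and ζ(s) have
modulus at least 1. Stirling finishes. -/
theorem exists_le_log_norm_xiEven :
    ∃ C : ℝ, 0 < C ∧ ∀ n : ℕ, 1 ≤ n →
      n * Real.log n - C * n ≤ Real.log ‖xiEven (2 * n + 3 / 2)‖ := by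
  have hlogpi : 0 < Real.log Real.pi := Real.log_pos (by linarith [Real.pi_gt_three])
  refine ⟨1 + 2 * Real.log Real.pi, by positivity, fun n hn => ?_⟩
  have hn1 : (1 : ℝ) ≤ n := by exact_mod_cast hn
  have hs : (1 : ℂ) / 2 + (2 * n + 3 / 2) = 2 * n + 2 := by ring
  have hre : (2 * n + 2 : ℂ).re = 2 * n + 2 := by simp
  have hne : (2 * n + 2 : ℂ) ≠ 1 := by
    intro h
    have := congrArg Complex.re h
    rw [hre] at this
    norm_num at this
    linarith
  have hx := xiEven_eq_zeta (z := 2 * n + 3 / 2) (by rw [hs, hre]; positivity) (by rwa [hs])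
  rw [hs] at hx
  have hG : Complex.Gammaℝ (2 * n + 2) = (((Real.pi ^ (n + 1))⁻¹ * n.factorial : ℝ) : ℂ) := by
    rw [Complex.Gammaℝ_def, show (2 * n + 2 : ℂ) / 2 = n + 1 by ring,
      Complex.Gamma_nat_eq_factorial,
      show -(2 * n + 2 : ℂ) / 2 = -((n + 1 : ℕ) : ℂ) by push_cast; ring, Complex.cpow_neg,
      Complex.cpow_natCast]
    push_cast
    rfl
  have h1 : (Real.pi ^ (n + 1))⁻¹ * n.factorial ≤ ‖xiEven (2 * n + 3 / 2)‖ := by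
    rw [hx, hG, norm_mul, norm_mul, norm_mul, Complex.norm_real, Real.norm_eq_abs,
      abs_of_pos (by positivity)]
    have ha : 1 ≤ ‖(2 * n + 2 : ℂ)‖ := by
      refine le_trans ?_ (Complex.re_le_norm _)
      rw [hre]; linarith
    have hb : 1 ≤ ‖(2 * n + 2 - 1 : ℂ)‖ := by
      refine le_trans ?_ (Complex.re_le_norm _)
      rw [Complex.sub_re, hre, Complex.one_re]; linarith
    have hc := one_le_norm_riemannZeta_even n
    have hd : 0 < (Real.pi ^ (n + 1))⁻¹ * n.factorial := by positivity
    calc (Real.pi ^ (n + 1))⁻¹ * n.factorial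
        = 1 * 1 * ((Real.pi ^ (n + 1))⁻¹ * n.factorial) * 1 := by ring
      _ ≤ _ := by gcongr
  have h2 := Real.log_le_log (by positivity) h1
  rw [Real.log_mul (by positivity) (by positivity), Real.log_inv, Real.log_pow] at h2
  have h3 := Stirling.le_log_factorial_stirling (n := n) (by omega)
  have h4 : 0 ≤ Real.log n := Real.log_nonneg hn1
  have h5 : 0 ≤ Real.log (2 * Real.pi) := Real.log_nonneg (by linarith [Real.pi_gt_three])
  push_cast at h2
  nlinarith

end CompletedZeta

/-! ### From the size of ξ to a sum over zeros. -/

section ZeroSum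

open ZetaPairs

theorem mem_zerosBetween {a b : ℝ} {ρ : ℂ} :
    ρ ∈ zerosBetween a b ↔ ρ ∈ nontrivialZeros ∧ a < ρ.im ∧ ρ.im ≤ b := by
  simp [zerosBetween, and_assoc]
  tauto

theorem exists_sq_eq_of_im_nonneg (u : ℂ) : ∃ z : ℂ, z ^ 2 = u ∧ 0 ≤ z.im := by
  obtain ⟨z, hz⟩ := IsAlgClosed.exists_pow_nat_eq u (n := 2) two_pos
  rcases le_total 0 z.im with h | h
  · exact ⟨z, hz, h⟩
  · exact ⟨-z, by rwa [neg_sq], by simpa using h⟩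

theorem norm_ofReal_sq_sub_le {x : ℝ} {z : ℂ} (hz : |z.re| < 1 / 2) :
    ‖(x : ℂ) ^ 2 - z ^ 2‖ ≤ x ^ 2 + z.im ^ 2 + 1 / 4 := by
  refine (norm_sub_le _ _).trans ?_
  rw [norm_pow, norm_pow, Complex.norm_real, Real.norm_eq_abs, sq_abs, Complex.sq_norm,
    Complex.normSq_apply]
  obtain ⟨h1, h2⟩ := abs_lt.mp hz
  nlinarith

theorem le_norm_sub_sq {z : ℂ} (hz : |z.re| < 1 / 2) :
    2 + z.im ^ 2 ≤ ‖(9 / 4 : ℂ) - z ^ 2‖ := by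
  refine le_trans ?_ (Complex.re_le_norm _)
  obtain ⟨h1, h2⟩ := abs_lt.mp hz
  have : ((9 / 4 : ℂ) - z ^ 2).re = 9 / 4 - (z.re ^ 2 - z.im ^ 2) := by
    rw [Complex.sub_re, sq z, Complex.mul_re]
    norm_num
    ring
  rw [this]
  nlinarith

/-- The centre 9/4 = (3/2)² lies far enough right that its distance to z² is at least 2 + γ², which
absorbs the 1/4 lost in the numerator. -/
theorem log_norm_div_le {x X : ℝ} {z : ℂ} (hx : 0 < x) (hxX : x ≤ X) (hz : |z.re| < 1 / 2)
    (hne : (x : ℂ) ^ 2 - z ^ 2 ≠ 0) (him : 0 < z.im) :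
    Real.log (‖(x : ℂ) ^ 2 - z ^ 2‖ / ‖(9 / 4 : ℂ) - z ^ 2‖) ≤
      Real.log (1 + X ^ 2 / z.im ^ 2) := by
  have h1 := norm_ofReal_sq_sub_le (x := x) hz
  have h2 := le_norm_sub_sq hz
  have h3 : 0 < ‖(9 / 4 : ℂ) - z ^ 2‖ := lt_of_lt_of_le (by positivity) h2
  refine Real.log_le_log (div_pos (norm_pos_iff.mpr hne) h3) ?_
  calc _ ≤ (x ^ 2 + z.im ^ 2 + 1 / 4) / (2 + z.im ^ 2) := by gcongr
    _ ≤ 1 + x ^ 2 / z.im ^ 2 := by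
      have : x ^ 2 / (2 + z.im ^ 2) ≤ x ^ 2 / z.im ^ 2 := by gcongr; linarith
      have h4 : (x ^ 2 + z.im ^ 2 + 1 / 4) / (2 + z.im ^ 2) ≤ 1 + x ^ 2 / (2 + z.im ^ 2) := by
        rw [div_le_iff₀ (by positivity), add_mul, div_mul_cancel₀ _ (by positivity)]
        linarith
      linarith
    _ ≤ _ := by gcongr

theorem log_norm_div_le_of_im_eq_zero {x : ℝ} {z : ℂ} (hx : 1 ≤ x) (hz : |z.re| < 1 / 2)
    (hne : (x : ℂ) ^ 2 - z ^ 2 ≠ 0) (him : z.im = 0) :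
    Real.log (‖(x : ℂ) ^ 2 - z ^ 2‖ / ‖(9 / 4 : ℂ) - z ^ 2‖) ≤ 2 * x := by
  have h1 := norm_ofReal_sq_sub_le (x := x) hz
  have h2 := le_norm_sub_sq hz
  rw [him] at h1 h2
  have h3 : 0 < ‖(9 / 4 : ℂ) - z ^ 2‖ := by linarith
  have h4 : ‖(x : ℂ) ^ 2 - z ^ 2‖ / ‖(9 / 4 : ℂ) - z ^ 2‖ ≤ x ^ 2 := by
    rw [div_le_iff₀ h3]
    nlinarith
  calc _ ≤ Real.log (x ^ 2) := Real.log_le_log (div_pos (norm_pos_iff.mpr hne) h3) h4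
    _ = 2 * Real.log x := by rw [Real.log_pow]; norm_num
    _ ≤ _ := by
      have := Real.log_le_sub_one_of_pos (show 0 < x by linarith)
      linarith

theorem finite_zeros_closedBall {F : ℂ → ℂ} (hF : ∀ z, F (z ^ 2) = xiEven z) (c : ℂ) (R : ℝ) :
    {u | u ∈ Metric.closedBall c R ∧ F u = 0}.Finite := by
  set Y := ‖c‖ + R + 1 with hY
  -- The left endpoint is strict; -1 admits possible real zeros.
  refine ((finite_nontrivialZeros_between (-1) Y).image (fun ρ => (ρ - 1 / 2) ^ 2)).subset ?_
  rintro u ⟨hu, hFu⟩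
  obtain ⟨z, rfl, hz⟩ := exists_sq_eq_of_im_nonneg u
  rw [hF] at hFu
  refine ⟨1 / 2 + z, ⟨mem_nontrivialZeros_of_xiEven_eq_zero hFu, ?_, ?_⟩, by ring⟩
  · simp; linarith
  · have h1 : ‖z ^ 2‖ ≤ ‖c‖ + R := by
      have h2 : ‖z ^ 2 - c‖ ≤ R := by simpa [dist_eq_norm] using hu
      have h3 := norm_le_norm_add_norm_sub c (z ^ 2)
      rw [norm_sub_rev] at h3
      linarith
    rw [norm_pow] at h1
    have h4 := Complex.abs_im_le_norm z
    have h5 := le_abs_self z.im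
    have : (1 / 2 + z).im = z.im := by simp
    rw [this]
    nlinarith [sq_nonneg (‖z‖ - 1)]

theorem analyticOrderNatAt_of_comp_sq {F : ℂ → ℂ} (hF : ∀ z, F (z ^ 2) = xiEven z) {z : ℂ}
    (hz : xiEven z = 0) (him : 0 < z.im) :
    analyticOrderNatAt F (z ^ 2) = mult (1 / 2 + z) := by
  have hz0 : z ≠ 0 := by
    rintro rfl
    simp at him
  have h1 : AnalyticAt ℂ (fun w : ℂ => w ^ 2) z := by fun_prop
  have h2 := analyticOrderAt_comp_of_deriv_ne_zero (f := F) h1 (by simpa using hz0)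
  have h3 : F ∘ (fun w : ℂ => w ^ 2) = xiEven := funext hF
  rw [h3, analyticOrderAt_xiEven (abs_re_lt_of_xiEven_eq_zero hz)] at h2
  rw [mult, analyticOrderNatAt, analyticOrderNatAt, h2]

/-- Exponent 3/2 in z becomes 3/4 in w = z², so radius about W⁴ gives exponent W³. -/
theorem exists_growth_comp_sq {F : ℂ → ℂ} (hF : ∀ z, F (z ^ 2) = xiEven z) :
    ∃ E : ℝ, 0 < E ∧ ∀ W : ℝ, 10 ≤ W → ∀ w ∈ Metric.sphere (9 / 4 : ℂ) (3 * W ^ 4),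
      ‖F w‖ ≤ ‖F (9 / 4)‖ * Real.exp (E * W ^ 3) := by
  have hFc : F (9 / 4) ≠ 0 := by
    have := hF (3 / 2)
    rw [show (9 / 4 : ℂ) = (3 / 2) ^ 2 by norm_num, this]
    exact xiEven_ne_zero_of_half_le_re (by norm_num)
  obtain ⟨C, hC, hb⟩ := exists_norm_xiEven_le
  refine ⟨6 * C + |Real.log ‖F (9 / 4)‖|, by positivity, fun W hW w hw => ?_⟩
  obtain ⟨z, rfl, -⟩ := exists_sq_eq_of_im_nonneg w
  rw [hF]
  have h1 : ‖z‖ ^ 2 ≤ (2 * W ^ 2) ^ 2 := by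
    have h2 : ‖z ^ 2 - 9 / 4‖ = 3 * W ^ 4 := by simpa [dist_eq_norm] using hw
    have h3 := norm_le_norm_add_norm_sub (9 / 4) (z ^ 2)
    rw [norm_sub_rev, norm_pow, h2] at h3
    norm_num at h3
    have : (10 : ℝ) ^ 4 ≤ W ^ 4 := by gcongr
    nlinarith
  have h2 : ‖z‖ ≤ 2 * W ^ 2 := le_of_sq_le_sq h1 (by positivity)
  have h3 : (1 + ‖z‖) ^ (3 / 2 : ℝ) ≤ 6 * W ^ 3 := by
    have h4 : 1 + ‖z‖ ≤ 3 * W ^ 2 := by nlinarith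
    have h5 : (1 + ‖z‖) ^ (3 / 2 : ℝ) ≤ (3 * W ^ 2) ^ (3 / 2 : ℝ) := by gcongr
    refine h5.trans ?_
    rw [Real.mul_rpow (by norm_num) (by positivity)]
    have h6 : (W ^ 2) ^ (3 / 2 : ℝ) = W ^ 3 := by
      rw [← Real.rpow_natCast W 2, ← Real.rpow_mul (by positivity), ← Real.rpow_natCast W 3]
      norm_num
    have h7 : (3 : ℝ) ^ (3 / 2 : ℝ) ≤ 6 := by
      have h8 : (0 : ℝ) ≤ 3 ^ (3 / 2 : ℝ) := by positivity
      have h9 : ((3 : ℝ) ^ (3 / 2 : ℝ)) ^ 2 = 27 := by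
        rw [← Real.rpow_natCast, ← Real.rpow_mul (by norm_num)]
        norm_num
      nlinarith
    rw [h6]
    gcongr
  have hpos : 0 < ‖F (9 / 4)‖ := norm_pos_iff.mpr hFc
  calc ‖xiEven z‖ ≤ Real.exp (C * (1 + ‖z‖) ^ (3 / 2 : ℝ)) := hb z
    _ ≤ Real.exp (Real.log ‖F (9 / 4)‖ + (6 * C + |Real.log ‖F (9 / 4)‖|) * W ^ 3) := by
        refine Real.exp_le_exp.mpr ?_
        have h4 : C * (1 + ‖z‖) ^ (3 / 2 : ℝ) ≤ C * (6 * W ^ 3) := by gcongr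
        have h5 := neg_abs_le (Real.log ‖F (9 / 4)‖)
        have h6 : (1 : ℝ) ≤ W ^ 3 := one_le_pow₀ (by linarith)
        have h7 := abs_nonneg (Real.log ‖F (9 / 4)‖)
        nlinarith
    _ = _ := by rw [Real.exp_add, Real.exp_log hpos]

set_option maxHeartbeats 800000 in
/-- A lower bound for the sum over zeros obtained from the size of `ξ` on the real axis. -/
theorem exists_le_sum_log_zeros :
    ∃ C : ℝ, 0 < C ∧ ∀ n : ℕ, 1 ≤ n → ∃ Y : ℝ,
      n * Real.log n - C * n ≤
        ∑ ρ ∈ zerosBetween 0 Y, (mult ρ : ℝ) * Real.log (1 + (2 * n + 2) ^ 2 / ρ.im ^ 2) := by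
  classical
  obtain ⟨F, hFd, hF⟩ := exists_entire_comp_sq differentiable_xiEven xiEven_neg
  have hFc : F (9 / 4) ≠ 0 := by
    have := hF (3 / 2)
    rw [show (9 / 4 : ℂ) = (3 / 2) ^ 2 by norm_num, this]
    exact xiEven_ne_zero_of_half_le_re (by norm_num)
  obtain ⟨E, hE, hgrowth⟩ := exists_growth_comp_sq hF
  obtain ⟨C, hC, hlow⟩ := exists_le_log_norm_xiEven
  set Z₁ := (finite_zeros_closedBall hF 0 1).toFinset with hZ₁
  -- Real zeros of ξ are not excluded. Their squares lie in the unit disc, so D bounds their number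
  -- independently of n and their contribution is O(n).
  set D : ℝ := ∑ u ∈ Z₁, (analyticOrderNatAt F u : ℝ) with hD
  have hD0 : 0 ≤ D := Finset.sum_nonneg fun u _ => by positivity
  -- A zero u of F stands for the pair ±z, that is ρ and 1 - ρ. The root in the upper half-plane
  -- selects the zero with γ > 0.
  choose r hr hrim using exists_sq_eq_of_im_nonneg
  refine ⟨C + |Real.log ‖F (9 / 4)‖| + 7 * D + 4 * E, by positivity, fun n hn => ?_⟩
  have hn1 : (1 : ℝ) ≤ n := by exact_mod_cast hn
  set x : ℝ := 2 * n + 3 / 2 with hx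
  set W : ℝ := x ^ 2 - 9 / 4 with hW
  have hW10 : 10 ≤ W := by rw [hW, hx]; nlinarith
  have hxz : xiEven x ≠ 0 := xiEven_ne_zero_of_half_le_re (by simp [hx]; linarith)
  have hFx : F ((x : ℂ) ^ 2) = xiEven x := hF x
  have hdist : ‖(x : ℂ) ^ 2 - 9 / 4‖ = W := by
    have : (x : ℂ) ^ 2 - 9 / 4 = ((W : ℝ) : ℂ) := by rw [hW]; push_cast; ring
    rw [this, Complex.norm_real, Real.norm_eq_abs, abs_of_pos (by linarith)]
  set Z := (finite_zeros_closedBall hF (9 / 4) (W ^ 4)).toFinset with hZ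
  have hZmem : ∀ u, u ∈ Z ↔ u ∈ Metric.closedBall (9 / 4 : ℂ) (W ^ 4) ∧ F u = 0 := by
    intro u; simp [hZ]
  have hWlt : W < W ^ 4 := by
    have : (10 : ℝ) ^ 3 ≤ W ^ 3 := by gcongr
    nlinarith
  have hmain := norm_le_prod_zeros hFd hFc (R := W ^ 4) (A := E * W ^ 3) (by positivity)
    (by positivity) Z hZmem (hgrowth W hW10) (w := (x : ℂ) ^ 2)
    (by rw [Metric.mem_ball, dist_eq_norm, hdist]; exact hWlt)
  rw [hdist, hFx] at hmain
  have hne : ∀ u ∈ Z, (x : ℂ) ^ 2 - u ≠ 0 := by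
    intro u hu h
    rw [← sub_eq_zero.mp h] at hu
    exact hxz (hFx ▸ ((hZmem _).mp hu).2)
  have hne' : ∀ u ∈ Z, (9 / 4 : ℂ) - u ≠ 0 := by
    intro u hu h
    rw [← sub_eq_zero.mp h] at hu
    exact hFc ((hZmem _).mp hu).2
  have hfac : ∀ u ∈ Z, (‖(x : ℂ) ^ 2 - u‖ / ‖(9 / 4 : ℂ) - u‖) ^ analyticOrderNatAt F u ≠ 0 :=
    fun u hu => pow_ne_zero _ (div_ne_zero (norm_ne_zero_iff.mpr (hne u hu))
      (norm_ne_zero_iff.mpr (hne' u hu)))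
  have hlog := Real.log_le_log (norm_pos_iff.mpr hxz) hmain
  rw [Real.log_mul (mul_ne_zero (norm_ne_zero_iff.mpr hFc) (Finset.prod_ne_zero_iff.mpr hfac))
    (Real.exp_pos _).ne', Real.log_mul (norm_ne_zero_iff.mpr hFc)
    (Finset.prod_ne_zero_iff.mpr hfac), Real.log_exp, Real.log_prod hfac] at hlog
  -- The radius W⁴ is chosen so that the Borel–Carathéodory error stays bounded at distance W from
  -- the centre.
  have herr : 2 * (E * W ^ 3) * W / (W ^ 4 - W) ≤ 4 * E := by
    rw [div_le_iff₀ (by linarith)]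
    have : 2 * W ≤ W ^ 4 := by
      have : (10 : ℝ) ^ 3 ≤ W ^ 3 := by gcongr
      nlinarith
    nlinarith
  have hxi : ∀ u ∈ Z, xiEven (r u) = 0 := fun u hu => by
    rw [← hF, hr]; exact ((hZmem u).mp hu).2
  set Y := 9 / 4 + W ^ 4 + 1 with hY
  refine ⟨Y, ?_⟩
  have hsplit : ∑ u ∈ Z, Real.log ((‖(x : ℂ) ^ 2 - u‖ / ‖(9 / 4 : ℂ) - u‖) ^
      analyticOrderNatAt F u) ≤ D * (2 * x) +
        ∑ ρ ∈ zerosBetween 0 Y, (mult ρ : ℝ) * Real.log (1 + (2 * n + 2) ^ 2 / ρ.im ^ 2) := by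
    rw [← Finset.sum_filter_add_sum_filter_not Z (fun u => (r u).im = 0)]
    refine add_le_add ?_ ?_
    · have h1 : ∀ u ∈ Z.filter (fun u => (r u).im = 0),
          Real.log ((‖(x : ℂ) ^ 2 - u‖ / ‖(9 / 4 : ℂ) - u‖) ^ analyticOrderNatAt F u) ≤
            analyticOrderNatAt F u * (2 * x) := by
        intro u hu
        obtain ⟨hu, him⟩ := Finset.mem_filter.mp hu
        rw [Real.log_pow]
        gcongr
        have h2 := log_norm_div_le_of_im_eq_zero (x := x) (z := r u) (by rw [hx]; linarith)
          (abs_re_lt_of_xiEven_eq_zero (hxi u hu)) (by rw [hr]; exact hne u hu) him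
        rwa [hr] at h2
      refine (Finset.sum_le_sum h1).trans ?_
      rw [← Finset.sum_mul]
      refine mul_le_mul_of_nonneg_right ?_ (by rw [hx]; positivity)
      refine Finset.sum_le_sum_of_subset_of_nonneg (fun u hu => ?_) fun u _ _ => by positivity
      obtain ⟨hu, him⟩ := Finset.mem_filter.mp hu
      rw [hZ₁, Set.Finite.mem_toFinset]
      refine ⟨?_, ((hZmem u).mp hu).2⟩
      have h3 := abs_lt.mp (abs_re_lt_of_xiEven_eq_zero (hxi u hu))
      rw [← hr u, Metric.mem_closedBall, dist_zero_right, norm_pow, Complex.sq_norm,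
        Complex.normSq_apply, him]
      nlinarith
    · have h1 : ∀ u ∈ Z.filter (fun u => ¬ (r u).im = 0), 0 < (r u).im := fun u hu =>
        lt_of_le_of_ne (hrim u) (Ne.symm (Finset.mem_filter.mp hu).2)
      have h2 : ∀ u ∈ Z.filter (fun u => ¬ (r u).im = 0),
          Real.log ((‖(x : ℂ) ^ 2 - u‖ / ‖(9 / 4 : ℂ) - u‖) ^ analyticOrderNatAt F u) ≤
            (mult (1 / 2 + r u) : ℝ) *
              Real.log (1 + (2 * n + 2) ^ 2 / (1 / 2 + r u).im ^ 2) := by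
        intro u hu
        have hu' := (Finset.mem_filter.mp hu).1
        have h3 := analyticOrderNatAt_of_comp_sq hF (hxi u hu') (h1 u hu)
        rw [hr] at h3
        rw [Real.log_pow, h3]
        refine mul_le_mul_of_nonneg_left ?_ (by positivity)
        have h4 := log_norm_div_le (x := x) (X := 2 * n + 2) (z := r u) (by rw [hx]; positivity)
          (by rw [hx]; linarith) (abs_re_lt_of_xiEven_eq_zero (hxi u hu'))
          (by rw [hr]; exact hne u hu') (h1 u hu)
        rw [hr] at h4
        simpa using h4
      refine (Finset.sum_le_sum h2).trans ?_
      have hinj : Set.InjOn (fun u => 1 / 2 + r u)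
          (Z.filter (fun u => ¬ (r u).im = 0) : Finset ℂ) := by
        intro u _ v _ huv
        have : r u = r v := by simpa using huv
        rw [← hr u, this, hr]
      rw [← Finset.sum_image (f := fun ρ : ℂ => (mult ρ : ℝ) *
        Real.log (1 + (2 * n + 2) ^ 2 / ρ.im ^ 2)) hinj]
      refine Finset.sum_le_sum_of_subset_of_nonneg (fun ρ hρ => ?_) fun ρ _ _ => ?_
      · obtain ⟨u, hu, rfl⟩ := Finset.mem_image.mp hρ
        have hu' := (Finset.mem_filter.mp hu).1
        refine mem_zerosBetween.mpr ⟨mem_nontrivialZeros_of_xiEven_eq_zero (hxi u hu'), ?_, ?_⟩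
        · simpa using h1 u hu
        · have h2 : ‖u - 9 / 4‖ ≤ W ^ 4 := by
            simpa [dist_eq_norm] using ((hZmem u).mp hu').1
          have h3 := norm_le_norm_add_norm_sub (9 / 4) u
          rw [norm_sub_rev] at h3
          norm_num at h3
          have h4 : ‖r u‖ ^ 2 = ‖u‖ := by rw [← norm_pow, hr]
          have h5 := Complex.abs_im_le_norm (r u)
          have h6 := le_abs_self (r u).im
          have : (1 / 2 + r u).im = (r u).im := by simp
          rw [this, hY]
          nlinarith [sq_nonneg (‖r u‖ - 1)]
      · have : 0 ≤ (2 * (n : ℝ) + 2) ^ 2 / ρ.im ^ 2 := by positivity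
        exact mul_nonneg (by positivity) (Real.log_nonneg (by linarith))
  have hl := hlow n hn
  have hxe : xiEven (2 * n + 3 / 2) = xiEven x := by rw [hx]; push_cast; rfl
  rw [hxe] at hl
  have h7 := le_abs_self (Real.log ‖F (9 / 4)‖)
  have h8 := abs_nonneg (Real.log ‖F (9 / 4)‖)
  have h9 : D * (2 * x) ≤ 7 * D * n := by rw [hx]; nlinarith
  nlinarith

end ZeroSum

/-! ### The Tauberian argument. -/

section Tauberian

open MeasureTheory

/-- The kernel `-d/dt log (1 + x² / t²)`. -/
def logKernel (x t : ℝ) : ℝ := 2 * x ^ 2 / (t * (t ^ 2 + x ^ 2))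

theorem logKernel_nonneg {x t : ℝ} (ht : 0 < t) : 0 ≤ logKernel x t := by
  unfold logKernel; positivity

theorem hasDerivAt_neg_log_one_add {x t : ℝ} (ht : 0 < t) :
    HasDerivAt (fun t : ℝ => -Real.log (1 + x ^ 2 / t ^ 2)) (logKernel x t) t := by
  have h1 : HasDerivAt (fun t : ℝ => 1 + x ^ 2 / t ^ 2)
      ((0 * t ^ 2 - x ^ 2 * (2 * t)) / (t ^ 2) ^ 2) t := by
    have h2 : HasDerivAt (fun t : ℝ => t ^ 2) (2 * t) t := by simpa using hasDerivAt_pow 2 t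
    exact ((hasDerivAt_const t (x ^ 2)).div h2 (by positivity)).const_add 1
  refine (h1.log (by positivity)).neg.congr_deriv ?_
  unfold logKernel
  field_simp
  ring

theorem tendsto_neg_log_one_add (x : ℝ) :
    Tendsto (fun t : ℝ => -Real.log (1 + x ^ 2 / t ^ 2)) atTop (𝓝 0) := by
  have h1 : Tendsto (fun t : ℝ => 1 + x ^ 2 / t ^ 2) atTop (𝓝 (1 + 0)) :=
    tendsto_const_nhds.add (tendsto_const_nhds.div_atTop (tendsto_pow_atTop two_ne_zero))
  have h2 := (h1.log (by norm_num)).neg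
  simpa using h2

theorem integrableOn_logKernel {g : ℝ} (x : ℝ) (hg : 0 < g) :
    IntegrableOn (logKernel x) (Set.Ioi g) :=
  integrableOn_Ioi_deriv_of_nonneg' (fun _ ht => hasDerivAt_neg_log_one_add (hg.trans_le ht))
    (fun _ ht => logKernel_nonneg (hg.trans ht)) (tendsto_neg_log_one_add x)

theorem integral_logKernel {g : ℝ} (x : ℝ) (hg : 0 < g) :
    ∫ t in Set.Ioi g, logKernel x t = Real.log (1 + x ^ 2 / g ^ 2) := by
  rw [integral_Ioi_of_hasDerivAt_of_nonneg'
    (fun _ ht => hasDerivAt_neg_log_one_add (hg.trans_le ht))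
    (fun _ ht => logKernel_nonneg (hg.trans ht)) (tendsto_neg_log_one_add x)]
  ring

/-- Partial summation: each logarithm is the integral of the kernel over (γ, ∞), so the sum is the
integral of the counting function against the kernel. -/
theorem sum_mul_log_le_integral {ι : Type*} (S : Finset ι) (m γ : ι → ℝ) {g : ℝ} (x : ℝ)
    (hg : 0 < g) (hγ : ∀ i ∈ S, g ≤ γ i) {G : ℝ → ℝ}
    (hG : IntegrableOn (fun t => G t * logKernel x t) (Set.Ioi g))
    (hle : ∀ t, g < t → ∑ i ∈ S with γ i < t, m i ≤ G t) :
    ∑ i ∈ S, m i * Real.log (1 + x ^ 2 / γ i ^ 2) ≤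
      ∫ t in Set.Ioi g, G t * logKernel x t := by
  have hInt : ∀ i ∈ S, IntegrableOn
      ((Set.Ioi (γ i)).indicator fun t => m i * logKernel x t) (Set.Ioi g) := by
    intro i _
    exact ((integrableOn_logKernel x hg).const_mul (m i)).indicator measurableSet_Ioi
  have h1 : ∀ i ∈ S, m i * Real.log (1 + x ^ 2 / γ i ^ 2) =
      ∫ t in Set.Ioi g, (Set.Ioi (γ i)).indicator (fun t => m i * logKernel x t) t := by
    intro i hi
    rw [setIntegral_indicator measurableSet_Ioi,
      Set.inter_eq_self_of_subset_right (Set.Ioi_subset_Ioi (hγ i hi)), integral_const_mul,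
      integral_logKernel x (hg.trans_le (hγ i hi))]
  rw [Finset.sum_congr rfl h1, ← integral_finsetSum _ hInt]
  refine setIntegral_mono_on (integrable_finsetSum _ hInt) hG measurableSet_Ioi fun t ht => ?_
  have h2 : ∑ i ∈ S, (Set.Ioi (γ i)).indicator (fun t => m i * logKernel x t) t =
      (∑ i ∈ S with γ i < t, m i) * logKernel x t := by
    rw [Finset.sum_mul, Finset.sum_filter]
    refine Finset.sum_congr rfl fun i _ => ?_
    simp [Set.indicator_apply]
  rw [h2]
  exact mul_le_mul_of_nonneg_right (hle t ht) (logKernel_nonneg (hg.trans ht))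

theorem integrableOn_sqrt_div_one_add_sq :
    IntegrableOn (fun u : ℝ => Real.sqrt u / (1 + u ^ 2)) (Set.Ioi 0) := by
  rw [← Set.Ioc_union_Ioi_eq_Ioi zero_le_one]
  refine IntegrableOn.union ?_ ?_
  · refine (Continuous.integrableOn_Icc ?_).mono_set Set.Ioc_subset_Icc_self
    exact Real.continuous_sqrt.div (by fun_prop) fun u => by positivity
  · have h1 : IntegrableOn (fun u : ℝ => u ^ (-(3 / 2) : ℝ)) (Set.Ioi 1) :=
      integrableOn_Ioi_rpow_of_lt (by norm_num) one_pos
    refine Integrable.mono' h1 ?_ ?_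
    · exact (Real.continuous_sqrt.div (by fun_prop) fun u => by positivity).aestronglyMeasurable
    · filter_upwards [ae_restrict_mem measurableSet_Ioi] with u hu
      have hu1 : (1 : ℝ) < u := hu
      have hu0 : 0 < u := by linarith
      rw [Real.norm_eq_abs, abs_of_nonneg (by positivity), Real.sqrt_eq_rpow,
        div_le_iff₀ (by positivity)]
      have h2 : u ^ (1 / 2 : ℝ) = u ^ (-(3 / 2) : ℝ) * u ^ 2 := by
        rw [← Real.rpow_natCast u 2, ← Real.rpow_add hu0]
        norm_num
      rw [h2]
      gcongr
      linarith

/-- A majorant of `t log t`, up to the factor `a`, adapted to the scale `x`. -/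
def logMajorant (a x t : ℝ) : ℝ := a * (t * (Real.log x + 2 * Real.sqrt (t / x)))

theorem log_le_log_add_sqrt {x t : ℝ} (hx : 0 < x) (ht : 0 < t) :
    Real.log t ≤ Real.log x + 2 * Real.sqrt (t / x) := by
  have h1 := Real.log_le_sub_one_of_pos (show 0 < Real.sqrt (t / x) by positivity)
  rw [Real.log_sqrt (by positivity), Real.log_div ht.ne' hx.ne'] at h1
  linarith

/-- Substituting t = xu leaves 2a(log x + 2√u)/(1 + u²). The integral π/2 of 1/(1 + u²) gives the
main term; the square root costs only O(x). -/
theorem integral_logMajorant_le {a x g : ℝ} (ha : 0 ≤ a) (hx : 1 ≤ x) (hg : 0 < g) :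
    IntegrableOn (fun t => logMajorant a x t * logKernel x t) (Set.Ioi g) ∧
    ∫ t in Set.Ioi g, logMajorant a x t * logKernel x t ≤
      a * Real.pi * (x * Real.log x) +
        4 * a * (∫ u in Set.Ioi (0 : ℝ), Real.sqrt u / (1 + u ^ 2)) * x := by
  have hx0 : 0 < x := by linarith
  have hlog : 0 ≤ Real.log x := Real.log_nonneg hx
  let ψ : ℝ → ℝ := fun u =>
    2 * a * Real.log x * (1 + u ^ 2)⁻¹ + 4 * a * (Real.sqrt u / (1 + u ^ 2))
  have hi1 : IntegrableOn (fun u : ℝ => 2 * a * Real.log x * (1 + u ^ 2)⁻¹) (Set.Ioi 0) :=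
    (integrable_inv_one_add_sq.integrableOn).const_mul _
  have hi2 : IntegrableOn (fun u : ℝ => 4 * a * (Real.sqrt u / (1 + u ^ 2))) (Set.Ioi 0) :=
    integrableOn_sqrt_div_one_add_sq.const_mul _
  have hψ : IntegrableOn ψ (Set.Ioi 0) := hi1.add hi2
  have hψx : IntegrableOn (fun t => ψ (x⁻¹ * t)) (Set.Ioi 0) := by
    rw [integrableOn_Ioi_comp_mul_left_iff ψ 0 (by positivity)]
    simpa using hψ
  have heq : ∀ t ∈ Set.Ioi (0 : ℝ), ψ (x⁻¹ * t) = logMajorant a x t * logKernel x t := by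
    intro t ht
    have ht0 : (0 : ℝ) < t := ht
    simp only [ψ, logMajorant, logKernel]
    rw [← div_eq_inv_mul]
    have h3 : 1 + (t / x) ^ 2 = (t ^ 2 + x ^ 2) / x ^ 2 := by field_simp; ring
    rw [h3]
    generalize Real.sqrt (t / x) = q
    field_simp
    ring
  have hI := hψx.congr_fun heq measurableSet_Ioi
  refine ⟨hI.mono_set (Set.Ioi_subset_Ioi hg.le), ?_⟩
  calc ∫ t in Set.Ioi g, logMajorant a x t * logKernel x t
      ≤ ∫ t in Set.Ioi 0, logMajorant a x t * logKernel x t := by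
        refine setIntegral_mono_set hI ?_ (Set.Ioi_subset_Ioi hg.le).eventuallyLE
        filter_upwards [ae_restrict_mem measurableSet_Ioi] with t ht
        have ht0 : (0 : ℝ) < t := ht
        have := logKernel_nonneg (x := x) ht0
        simp only [Pi.zero_apply, logMajorant]
        positivity
    _ = ∫ t in Set.Ioi 0, ψ (x⁻¹ * t) := (setIntegral_congr_fun measurableSet_Ioi heq).symm
    _ = x * ∫ u in Set.Ioi 0, ψ u := by
        rw [integral_comp_mul_left_Ioi ψ 0 (by positivity)]
        simp
    _ = _ := by
        rw [integral_add hi1 hi2, integral_const_mul, integral_const_mul,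
          integral_Ioi_inv_one_add_sq, Real.arctan_zero]
        ring

/-- For t ≤ T ≤ x the kernel is at least 1/t ≥ 1/T, so lowering the majorant by d on (T₁, T] saves
at least d(T - T₁)/T. -/
theorem integral_majorant_sub_indicator_le {a x g B d T₁ T : ℝ} (ha : 0 ≤ a) (hx : 1 ≤ x)
    (hg : 0 < g) (hd : 0 ≤ d) (hgT : g ≤ T₁) (hT : T₁ ≤ T) (hTx : T ≤ x) :
    IntegrableOn (fun t => (logMajorant a x t + B - (Set.Ioc T₁ T).indicator (fun _ => d) t) *
      logKernel x t) (Set.Ioi g) ∧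
    ∫ t in Set.Ioi g, (logMajorant a x t + B - (Set.Ioc T₁ T).indicator (fun _ => d) t) *
      logKernel x t ≤
      a * Real.pi * (x * Real.log x) +
        4 * a * (∫ u in Set.Ioi (0 : ℝ), Real.sqrt u / (1 + u ^ 2)) * x +
        B * Real.log (1 + x ^ 2 / g ^ 2) - d * ((T - T₁) / T) := by
  obtain ⟨h1, h2⟩ := integral_logMajorant_le ha hx hg
  have hk := integrableOn_logKernel x hg
  have hT0 : 0 < T := by linarith
  have h3 : IntegrableOn ((Set.Ioc T₁ T).indicator fun t => d * logKernel x t) (Set.Ioi g) :=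
    (hk.const_mul d).indicator measurableSet_Ioc
  have heq : (fun t => (logMajorant a x t + B - (Set.Ioc T₁ T).indicator (fun _ => d) t) *
      logKernel x t) = fun t => (logMajorant a x t * logKernel x t + B * logKernel x t) -
        (Set.Ioc T₁ T).indicator (fun t => d * logKernel x t) t := by
    funext t
    by_cases ht : t ∈ Set.Ioc T₁ T
    · simp only [Set.indicator_of_mem ht]; ring
    · simp only [Set.indicator_of_notMem ht]; ring
  rw [heq]
  have h4 : IntegrableOn (fun t => logMajorant a x t * logKernel x t + B * logKernel x t)
      (Set.Ioi g) := h1.add (hk.const_mul B)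
  refine ⟨h4.sub h3, ?_⟩
  rw [integral_sub h4 h3, integral_add h1 (hk.const_mul B), integral_const_mul,
    integral_logKernel x hg, setIntegral_indicator measurableSet_Ioc,
    Set.inter_eq_self_of_subset_right (s := Set.Ioi g) (t := Set.Ioc T₁ T)
      (fun t ht => lt_of_le_of_lt hgT ht.1)]
  have h5 : d * ((T - T₁) / T) ≤ ∫ t in Set.Ioc T₁ T, d * logKernel x t := by
    have h6 : ∫ _ in Set.Ioc T₁ T, d / T = d * ((T - T₁) / T) := by
      rw [setIntegral_const, Real.volume_real_Ioc_of_le hT, smul_eq_mul]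
      ring
    rw [← h6]
    refine setIntegral_mono_on (by simp) ?_ measurableSet_Ioc fun t ht => ?_
    · exact IntegrableOn.mono_set (t := Set.Ioi g) (hk.const_mul d) fun t ht =>
        lt_of_le_of_lt hgT ht.1
    · have ht0 : 0 < t := by linarith [ht.1]
      have h7 : 1 / T ≤ logKernel x t := by
        unfold logKernel
        rw [div_le_div_iff₀ hT0 (by positivity)]
        have h8 : t ^ 2 ≤ x ^ 2 := by
          have := ht.2.trans hTx
          gcongr
        have h9 : t * (t ^ 2 + x ^ 2) ≤ T * (x ^ 2 + x ^ 2) := by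
          gcongr
          exact ht.2
        linarith
      calc d / T = d * (1 / T) := by ring
        _ ≤ _ := by gcongr
  linarith

/-- Both main terms are (T/2) log T up to O(T). The excess ε costs (κδ/2) T log T while the deficit
saves κδ T log T; the remaining half beats every O(T) term. -/
theorem not_large_deficit {C ε κ δ B g I : ℝ} (hδκ : 0 < κ * δ) (hε : ε = κ * δ) (hg : 0 < g)
    (hB : 0 ≤ B) (hI : 0 ≤ I) (hC : 0 ≤ C) : ∀ᶠ T : ℝ in atTop, ∀ n : ℕ, 2 * (n : ℝ) ≤ T →
      T < 2 * n + 2 →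
      (1 + ε) / (2 * Real.pi) * Real.pi * ((2 * n + 2) * Real.log (2 * n + 2)) +
        4 * ((1 + ε) / (2 * Real.pi)) * I * (2 * n + 2) +
        B * Real.log (1 + (2 * n + 2) ^ 2 / g ^ 2) - κ * (T * Real.log T) * δ
      < n * Real.log n - C * n := by
  set a := (1 + ε) / (2 * Real.pi) with ha
  have hε0 : 0 < ε := hε ▸ hδκ
  have ha0 : 0 < a := by positivity
  set K := 1 + C + 2 + Real.log 4 + (1 + ε) * 8 + 8 * a * I + 4 * B / g with hK
  have hlog := Real.tendsto_log_atTop.eventually_gt_atTop (2 * K / (κ * δ))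
  filter_upwards [hlog, eventually_ge_atTop 8] with T hT hT8 n hn hn'
  have hT0 : 0 < T := by linarith
  have hlogT : 0 ≤ Real.log T := Real.log_nonneg (by linarith)
  have hlogT' : Real.log T ≤ T := by
    have := Real.log_le_sub_one_of_pos hT0
    linarith
  have hn0 : 0 < (n : ℝ) := by linarith
  have hapi : a * Real.pi = (1 + ε) / 2 := by rw [ha]; field_simp
  set x : ℝ := 2 * n + 2 with hx
  have hxT : x ≤ T + 2 := by linarith
  have hx0 : 0 < x := by linarith
  have hxlog : x * Real.log x ≤ T * Real.log T + 2 * Real.log T + 4 := by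
    have h1 : Real.log x ≤ Real.log T + 2 / T := by
      have h2 : Real.log x ≤ Real.log (T * (1 + 2 / T)) := by
        refine Real.log_le_log hx0 ?_
        have : T * (1 + 2 / T) = T + 2 := by field_simp
        linarith
      rw [Real.log_mul hT0.ne' (by positivity)] at h2
      have h3 := Real.log_le_sub_one_of_pos (show 0 < 1 + 2 / T by positivity)
      linarith
    calc x * Real.log x ≤ (T + 2) * (Real.log T + 2 / T) := by
          gcongr
          exact Real.log_nonneg (by linarith)
      _ = T * Real.log T + 2 * Real.log T + 2 + 4 / T := by field_simp; ring
      _ ≤ _ := by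
        have : 4 / T ≤ 1 := by rw [div_le_one hT0]; linarith
        linarith
  have hnlog : T / 2 * Real.log T - Real.log T - T * Real.log 4 ≤ n * Real.log n := by
    have h1 : Real.log T - Real.log 4 ≤ Real.log n := by
      rw [← Real.log_div hT0.ne' (by norm_num)]
      exact Real.log_le_log (by positivity) (by linarith)
    have h2 : Real.log 4 ≤ Real.log T := Real.log_le_log (by norm_num) (by linarith)
    have h3 : 0 ≤ Real.log 4 := Real.log_nonneg (by norm_num)
    have h4 : (T / 2 - 1) * (Real.log T - Real.log 4) ≤ n * Real.log n := by
      gcongr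
      linarith
    nlinarith
  have hBlog : B * Real.log (1 + x ^ 2 / g ^ 2) ≤ 4 * B / g * T := by
    have h1 : Real.log (1 + x ^ 2 / g ^ 2) ≤ 2 * (x / g) := by
      have h2 : Real.log (1 + x ^ 2 / g ^ 2) ≤ Real.log ((1 + x / g) ^ 2) := by
        refine Real.log_le_log (by positivity) ?_
        have : 0 ≤ x / g := by positivity
        rw [← div_pow]
        nlinarith
      rw [Real.log_pow] at h2
      have h3 := Real.log_le_sub_one_of_pos (show 0 < 1 + x / g by positivity)
      push_cast at h2
      linarith
    calc B * Real.log (1 + x ^ 2 / g ^ 2) ≤ B * (2 * (x / g)) := by gcongr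
      _ ≤ B * (2 * (2 * T / g)) := by gcongr; linarith
      _ = _ := by ring
  have hI' : 4 * a * I * x ≤ 8 * a * I * T := by
    have : 4 * a * I * x ≤ 4 * a * I * (2 * T) := by gcongr; linarith
    linarith
  have hCn : C * n ≤ C * T := by gcongr; linarith
  have hfin : 2 * K < κ * δ * Real.log T := by
    rw [div_lt_iff₀ hδκ] at hT
    linarith
  have hfin' : 2 * K * T < κ * δ * Real.log T * T := by gcongr
  have hl4 : 0 ≤ Real.log 4 := Real.log_nonneg (by norm_num)
  have hKT : K * T = T + C * T + 2 * T + T * Real.log 4 + (1 + ε) * 8 * T + 8 * a * I * T +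
      4 * B / g * T := by rw [hK]; ring
  rw [hapi]
  have hx2 : (1 + ε) / 2 * (x * Real.log x) ≤
      (1 + ε) / 2 * (T * Real.log T + 2 * Real.log T + 4) := by gcongr
  have h10 : (1 + ε) / 2 * (2 * Real.log T + 4) ≤ (1 + ε) * 8 * T := by
    have : 2 * Real.log T + 4 ≤ 16 * T := by linarith
    nlinarith
  have h11 : (1 + ε) / 2 * (T * Real.log T) =
      T / 2 * Real.log T + (κ * δ * Real.log T * T) / 2 := by rw [hε]; ring
  nlinarith

/-- A counting function majorised by `t log t / 2π` whose logarithmic transform is as large as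
possible is asymptotic to `t log t / 2π`. -/
theorem eventually_le_of_integral_lower_bound {N : ℝ → ℝ} (hmono : Monotone N) {g C : ℝ}
    (hg : 0 < g) (hC : 0 ≤ C)
    (hup : ∀ ε : ℝ, 0 < ε → ∃ B : ℝ, 0 ≤ B ∧ ∀ t, g < t →
      N t ≤ (1 + ε) / (2 * Real.pi) * (t * Real.log t) + B)
    (hlow : ∀ n : ℕ, 1 ≤ n → ∀ G : ℝ → ℝ,
      IntegrableOn (fun t => G t * logKernel (2 * n + 2) t) (Set.Ioi g) →
      (∀ t, g < t → N t ≤ G t) →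
      n * Real.log n - C * n ≤ ∫ t in Set.Ioi g, G t * logKernel (2 * n + 2) t)
    {η : ℝ} (hη : 0 < η) (hη1 : η < 1) :
    ∀ᶠ T : ℝ in atTop, (1 - η) / (2 * Real.pi) * (T * Real.log T) ≤ N T := by
  set δ := η / 2 with hδ
  -- On ((1 - δ)T, T] the majorant exceeds N by at least (η - δ)/(2π) = η/(4π) times T log T; κ is
  -- half of this.
  set κ := η / (8 * Real.pi) with hκ
  have hκδ : 0 < κ * δ := by positivity
  obtain ⟨B, hB, hNB⟩ := hup (κ * δ) hκδ
  set a := (1 + κ * δ) / (2 * Real.pi) with ha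
  have ha0 : 0 < a := by positivity
  set I := ∫ u in Set.Ioi (0 : ℝ), Real.sqrt u / (1 + u ^ 2) with hI
  have hI0 : 0 ≤ I := setIntegral_nonneg measurableSet_Ioi fun u _ => by positivity
  filter_upwards [not_large_deficit (C := C) hκδ rfl hg hB hI0 hC, eventually_ge_atTop (2 * g),
    eventually_ge_atTop 8] with T hT hTg hT8
  by_contra! hcon
  have hT0 : 0 < T := by linarith
  have hlogT : 0 ≤ Real.log T := Real.log_nonneg (by linarith)
  set n := ⌊T / 2⌋₊ with hn
  have hn1 : 2 * (n : ℝ) ≤ T := by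
    have := Nat.floor_le (show 0 ≤ T / 2 by positivity)
    linarith
  have hn2 : T < 2 * n + 2 := by
    have := Nat.lt_floor_add_one (T / 2)
    linarith
  have hn3 : 1 ≤ n := by
    have : (0 : ℝ) < n := by linarith
    exact_mod_cast this
  have hdef := hT n hn1 hn2
  have hx1 : (1 : ℝ) ≤ 2 * n + 2 := by linarith
  have hT₁ : g ≤ (1 - δ) * T := by rw [hδ]; nlinarith
  obtain ⟨h1, h2⟩ := integral_majorant_sub_indicator_le (a := a) (x := 2 * n + 2) (g := g) (B := B)
    (d := κ * (T * Real.log T)) (T₁ := (1 - δ) * T) (T := T) ha0.le hx1 hg (by positivity) hT₁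
    (by rw [hδ]; nlinarith) hn2.le
  have h3 := hlow n hn3 _ h1 ?_
  · have h4 : (T - (1 - δ) * T) / T = δ := by field_simp; ring
    rw [h4] at h2
    linarith
  · intro t ht
    have ht0 : 0 < t := hg.trans ht
    by_cases htT : t ∈ Set.Ioc ((1 - δ) * T) T
    · rw [Set.indicator_of_mem htT]
      have h5 : 1 / (2 * Real.pi) * ((1 - δ) * T * Real.log T) ≤ logMajorant a (2 * n + 2) t := by
        have h6 : Real.log T ≤ Real.log (2 * n + 2) + 2 * Real.sqrt (t / (2 * n + 2)) := by
          have := Real.log_le_log hT0 hn2.le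
          have := Real.sqrt_nonneg (t / (2 * n + 2))
          linarith
        unfold logMajorant
        have h7 : 1 / (2 * Real.pi) ≤ a := by
          rw [ha]; gcongr; linarith
        have h8 := htT.1.le
        have h9 : 0 ≤ (1 - δ) * T := by linarith
        gcongr
      have h10 := hmono htT.2
      have h11 : 1 / (2 * Real.pi) * ((1 - δ) * T * Real.log T) - κ * (T * Real.log T) -
          (1 - η) / (2 * Real.pi) * (T * Real.log T) =
          η / (8 * Real.pi) * (T * Real.log T) := by
        rw [hδ, hκ]; field_simp; ring
      have h12 : 0 ≤ η / (8 * Real.pi) * (T * Real.log T) := by positivity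
      linarith
    · rw [Set.indicator_of_notMem htT, sub_zero]
      refine (hNB t ht).trans ?_
      unfold logMajorant
      have h6 := log_le_log_add_sqrt (x := 2 * n + 2) (by linarith) ht0
      gcongr

end Tauberian

/-! ### Counting zeros by pairs. -/

section Counting

open ZetaPairs

theorem zeroCount_mono : Monotone fun T : ℝ => (zeroCount T : ℝ) := by
  intro a b hab
  simp only [Nat.cast_le]
  refine Finset.sum_le_sum_of_subset fun ρ hρ => ?_
  rw [mem_zerosBetween] at hρ ⊢
  exact ⟨hρ.1, hρ.2.1, hρ.2.2.trans hab⟩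

theorem sum_zerosBetween_add {a T : ℝ} (ha : 0 ≤ a) (haT : a ≤ T) :
    (zeroCount a : ℝ) + ∑ ρ ∈ zerosBetween a T, (mult ρ : ℝ) = zeroCount T := by
  classical
  have hdisj : Disjoint (zerosBetween 0 a) (zerosBetween a T) := by
    rw [Finset.disjoint_left]
    intro ρ h1 h2
    rw [mem_zerosBetween] at h1 h2
    linarith [h1.2.2, h2.2.1]
  have hunion : zerosBetween 0 a ∪ zerosBetween a T = zerosBetween 0 T := by
    ext ρ
    simp only [Finset.mem_union, mem_zerosBetween]
    constructor
    · rintro (⟨h, h1, h2⟩ | ⟨h, h1, h2⟩)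
      · exact ⟨h, h1, h2.trans haT⟩
      · exact ⟨h, ha.trans_lt h1, h2⟩
    · rintro ⟨h, h1, h2⟩
      rcases le_or_gt ρ.im a with h3 | h3
      · exact Or.inl ⟨h, h1, h3⟩
      · exact Or.inr ⟨h, h3, h2⟩
  unfold zeroCount
  rw [← hunion, Finset.sum_union hdisj]
  push_cast
  rfl

/-- A positive lower limit for the integrals, away from the singularity of the kernel at 0. -/
theorem exists_pos_le_im :
    ∃ g : ℝ, 0 < g ∧ ∀ ρ ∈ nontrivialZeros, 0 < ρ.im → g ≤ ρ.im := by
  classical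
  set S := insert 1 ((zerosBetween 0 1).image Complex.im) with hS
  have hne : S.Nonempty := ⟨1, Finset.mem_insert_self _ _⟩
  refine ⟨S.min' hne, ?_, fun ρ hρ him => ?_⟩
  · rw [Finset.lt_min'_iff]
    intro y hy
    rcases Finset.mem_insert.mp hy with rfl | hy
    · exact one_pos
    · obtain ⟨ρ, hρ, rfl⟩ := Finset.mem_image.mp hy
      exact (mem_zerosBetween.mp hρ).2.1
  · rcases le_or_gt ρ.im 1 with h | h
    · refine Finset.min'_le _ _ (Finset.mem_insert_of_mem (Finset.mem_image_of_mem _ ?_))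
      exact mem_zerosBetween.mpr ⟨hρ, him, h⟩
    · exact (Finset.min'_le _ _ (Finset.mem_insert_self _ _)).trans h.le

/-- The truncation height Y disappears, since the zeros below both t and Y number at most N(t). -/
theorem zeroCount_integral_lower_bound {C g : ℝ} (hg : 0 < g)
    (hgρ : ∀ ρ ∈ nontrivialZeros, 0 < ρ.im → g ≤ ρ.im)
    (hC : ∀ n : ℕ, 1 ≤ n → ∃ Y : ℝ,
      n * Real.log n - C * n ≤
        ∑ ρ ∈ zerosBetween 0 Y, (mult ρ : ℝ) * Real.log (1 + (2 * n + 2) ^ 2 / ρ.im ^ 2))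
    (n : ℕ) (hn : 1 ≤ n) (G : ℝ → ℝ)
    (hG : MeasureTheory.IntegrableOn (fun t => G t * logKernel (2 * n + 2) t) (Set.Ioi g))
    (hle : ∀ t, g < t → (zeroCount t : ℝ) ≤ G t) :
    n * Real.log n - C * n ≤ ∫ t in Set.Ioi g, G t * logKernel (2 * n + 2) t := by
  obtain ⟨Y, hY⟩ := hC n hn
  refine hY.trans (sum_mul_log_le_integral (zerosBetween 0 Y) (fun ρ => (mult ρ : ℝ)) Complex.im
    (2 * n + 2) hg (fun ρ hρ => ?_) hG fun t ht => le_trans ?_ (hle t ht))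
  · obtain ⟨h1, h2, -⟩ := mem_zerosBetween.mp hρ
    exact hgρ ρ h1 h2
  · unfold zeroCount
    push_cast
    refine Finset.sum_le_sum_of_subset_of_nonneg (fun ρ hρ => ?_) fun _ _ _ => by positivity
    obtain ⟨h1, h2⟩ := Finset.mem_filter.mp hρ
    obtain ⟨h3, h4, -⟩ := mem_zerosBetween.mp h1
    exact mem_zerosBetween.mpr ⟨h3, h4, h2.le⟩

/-- The number of close pairs of zeros, counted with multiplicity. -/
def pairCount (M T : ℝ) : ℝ := ∑ p ∈ pairsNear M 0 T, ((mult p.1 * mult p.2 : ℕ) : ℝ)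

theorem mem_pairsNear_zero {M T : ℝ} (hM : 0 < M) {ρ ρ' : ℂ}
    (h : ρ ∈ zerosBetween (T / Real.log T ^ 2) T) (h' : ρ' ∈ zerosBetween (T / Real.log T ^ 2) T)
    (him : ρ.im = ρ'.im) : (ρ, ρ') ∈ pairsNear M 0 T := by
  simp only [pairsNear, closePairs, Finset.mem_filter, Finset.mem_product]
  refine ⟨⟨⟨h, h'⟩, ?_⟩, ?_, ?_⟩ <;> rw [him] <;> norm_num
  exact hM.le

/-- Each zero contributes the pair `(ρ, ρ)` and, off the critical line, the pair `(ρ, 1 - conj ρ)`. -/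
theorem two_mul_sum_mult_le {M T : ℝ} (hM : 0 < M) (hT : 0 ≤ T) :
    2 * ∑ ρ ∈ zerosBetween (T / Real.log T ^ 2) T, (mult ρ : ℝ) ≤
      simpleCriticalZeroCount T + pairCount M T := by
  classical
  set S := zerosBetween (T / Real.log T ^ 2) T with hS
  have hmem : ∀ ρ ∈ S, ρ ∈ nontrivialZeros := fun ρ h => (mem_zerosBetween.mp h).1
  have hrefl : ∀ ρ ∈ S, 1 - (starRingEnd ℂ) ρ ∈ S := by
    intro ρ h
    obtain ⟨h1, h2, h3⟩ := mem_zerosBetween.mp h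
    exact mem_zerosBetween.mpr ⟨one_sub_conj_mem_nontrivialZeros h1, by simpa using h2,
      by simpa using h3⟩
  set Off := S.filter fun ρ => ρ.re ≠ 1 / 2 with hOff
  set D₁ := S.image fun ρ => (ρ, ρ) with hD₁
  set D₂ := Off.image fun ρ => (ρ, 1 - (starRingEnd ℂ) ρ) with hD₂
  have hdisj : Disjoint D₁ D₂ := by
    rw [Finset.disjoint_left]
    intro p h1 h2
    obtain ⟨ρ, -, rfl⟩ := Finset.mem_image.mp h1
    obtain ⟨ρ', hρ', h3⟩ := Finset.mem_image.mp h2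
    simp only [Prod.mk.injEq] at h3
    obtain ⟨rfl, h4⟩ := h3
    apply (Finset.mem_filter.mp hρ').2
    have := congrArg Complex.re h4
    simp at this
    linarith
  have hsub : D₁ ∪ D₂ ⊆ pairsNear M 0 T := by
    intro p hp
    rcases Finset.mem_union.mp hp with h | h
    · obtain ⟨ρ, hρ, rfl⟩ := Finset.mem_image.mp h
      exact mem_pairsNear_zero hM hρ hρ rfl
    · obtain ⟨ρ, hρ, rfl⟩ := Finset.mem_image.mp h
      have hρS := (Finset.mem_filter.mp hρ).1
      exact mem_pairsNear_zero hM hρS (hrefl ρ hρS) (by simp)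
  have hpairs : ∑ ρ ∈ S, mult ρ * mult ρ +
      ∑ ρ ∈ S, (if ρ.re ≠ 1 / 2 then mult ρ * mult (1 - (starRingEnd ℂ) ρ) else 0) ≤
      ∑ p ∈ pairsNear M 0 T, mult p.1 * mult p.2 := by
    refine le_trans (le_of_eq ?_) (Finset.sum_le_sum_of_subset hsub)
    rw [Finset.sum_union hdisj, hD₁, hD₂, Finset.sum_image, Finset.sum_image, Finset.sum_filter]
    · intro a _ b _ h
      exact (Prod.mk.inj h).1
    · intro a _ b _ h
      exact (Prod.mk.inj h).1
  have hsimple : ∑ ρ ∈ S, (if mult ρ = 1 ∧ ρ.re = 1 / 2 then 1 else 0) ≤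
      simpleCriticalZeroCount T := by
    rw [← Finset.card_filter, simpleCriticalZeroCount]
    refine Finset.card_le_card fun ρ hρ => ?_
    obtain ⟨h1, h2⟩ := Finset.mem_filter.mp hρ
    obtain ⟨h3, h4, h5⟩ := mem_zerosBetween.mp h1
    exact Finset.mem_filter.mpr ⟨mem_zerosBetween.mpr ⟨h3, lt_of_le_of_lt (by positivity) h4, h5⟩,
      h2⟩
  -- On the line, 2 = 1 + 1 if m = 1 and 2m ≤ m² if m ≥ 2; off the line, m² and m·m' are each at
  -- least m.
  have hpoint : ∀ ρ ∈ S, 2 * mult ρ ≤ (if mult ρ = 1 ∧ ρ.re = 1 / 2 then 1 else 0) +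
      (mult ρ * mult ρ + if ρ.re ≠ 1 / 2 then mult ρ * mult (1 - (starRingEnd ℂ) ρ) else 0) := by
    intro ρ hρ
    have h1 := one_le_mult (hmem ρ hρ)
    have h2 := one_le_mult (hmem _ (hrefl ρ hρ))
    by_cases hc : ρ.re = 1 / 2
    · by_cases hm : mult ρ = 1
      · simp [hc, hm]
      · have : 2 ≤ mult ρ := by omega
        simp only [hm, hc, ne_eq, not_true_eq_false, if_false, false_and]
        nlinarith
    · simp only [hc, ne_eq, not_false_eq_true, if_true, and_false, if_false]
      nlinarith
  have hfinal : 2 * ∑ ρ ∈ S, mult ρ ≤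
      simpleCriticalZeroCount T + ∑ p ∈ pairsNear M 0 T, mult p.1 * mult p.2 := by
    rw [Finset.mul_sum]
    refine (Finset.sum_le_sum hpoint).trans ?_
    rw [Finset.sum_add_distrib, Finset.sum_add_distrib]
    exact add_le_add hsimple hpairs
  unfold pairCount
  exact_mod_cast hfinal

theorem simpleCriticalZeroCount_le (T : ℝ) : simpleCriticalZeroCount T ≤ zeroCount T := by
  classical
  rw [simpleCriticalZeroCount, Finset.card_filter, zeroCount]
  refine Finset.sum_le_sum fun ρ hρ => ?_
  have := one_le_mult (mem_zerosBetween.mp hρ).1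
  split_ifs <;> omega

theorem sum_mult_le_pairCount {M T : ℝ} (hM : 0 < M) :
    ∑ ρ ∈ zerosBetween (T / Real.log T ^ 2) T, (mult ρ : ℝ) ≤ pairCount M T := by
  classical
  have hsub : (zerosBetween (T / Real.log T ^ 2) T).image (fun ρ => (ρ, ρ)) ⊆
      pairsNear M 0 T := by
    intro p hp
    obtain ⟨ρ, hρ, rfl⟩ := Finset.mem_image.mp hp
    exact mem_pairsNear_zero hM hρ hρ rfl
  have h : ∑ ρ ∈ zerosBetween (T / Real.log T ^ 2) T, mult ρ ≤
      ∑ p ∈ pairsNear M 0 T, mult p.1 * mult p.2 := by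
    refine le_trans ?_ (Finset.sum_le_sum_of_subset hsub)
    rw [Finset.sum_image fun a _ b _ h => (Prod.mk.inj h).1]
    exact Finset.sum_le_sum fun ρ _ => Nat.le_mul_self _
  unfold pairCount
  exact_mod_cast h

theorem eventually_pairCount_le {M : ℝ} (hp : HasLimitingDensity M 0 1) {ε : ℝ} (hε : 0 < ε) :
    ∀ᶠ T : ℝ in atTop, pairCount M T ≤ (1 + ε) * (T * L T) := by
  have h1 := hp.eventually_lt_const (show (1 : ℝ) < 1 + ε by linarith)
  filter_upwards [h1, eventually_gt_atTop 1] with T h2 hT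
  have hTL : 0 < T * L T := by
    have := Real.log_pos hT
    unfold L
    have := Real.pi_pos
    positivity
  have h3 : (T * L T)⁻¹ * pairCount M T < 1 + ε := h2
  rw [inv_mul_lt_iff₀ hTL] at h3
  linarith

theorem zeroCount_le_add_pairCount {M T : ℝ} (hM : 0 < M) (hT : 0 ≤ T)
    (hlog : 1 ≤ Real.log T ^ 2) :
    (zeroCount T : ℝ) ≤ zeroCount (T / Real.log T ^ 2) + pairCount M T := by
  rw [← sum_zerosBetween_add (a := T / Real.log T ^ 2) (by positivity) (div_le_self hT hlog)]
  gcongr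
  exact sum_mult_le_pairCount hM

theorem L_mono {a b : ℝ} (ha : 0 < a) (hab : a ≤ b) : L a ≤ L b := by
  unfold L
  have := Real.log_le_log ha hab
  have := Real.pi_pos
  gcongr

theorem L_nonneg {a : ℝ} (ha : 1 ≤ a) : 0 ≤ L a := by
  unfold L
  have := Real.log_nonneg ha
  have := Real.pi_pos
  positivity

/-- Since log² T ≥ 4, N(T) ≤ N(T/4) + 2TL. Induction on scales 4^k closes, as 4(T/4)L + 2TL ≤ 4TL.
-/
theorem exists_zeroCount_le {M : ℝ} (hM : 0 < M) (hp : HasLimitingDensity M 0 1) :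
    ∃ T₁ : ℝ, 1 ≤ T₁ ∧ ∀ T, T₁ ≤ T → (zeroCount T : ℝ) ≤ 4 * (T * L T) + zeroCount T₁ := by
  have hev := (eventually_pairCount_le hp one_pos).and
    ((Real.tendsto_log_atTop.eventually_ge_atTop 2).and (eventually_ge_atTop 1))
  obtain ⟨T₁, hT₁⟩ := eventually_atTop.mp hev
  have h1 : 1 ≤ T₁ := (hT₁ T₁ le_rfl).2.2
  have hstep : ∀ k : ℕ, ∀ T, T₁ ≤ T → T ≤ 4 ^ k * T₁ →
      (zeroCount T : ℝ) ≤ 4 * (T * L T) + zeroCount T₁ := by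
    intro k
    induction k with
    | zero =>
      intro T hT hT'
      have hTT : T = T₁ := le_antisymm (by simpa using hT') hT
      subst hTT
      have := L_nonneg h1
      have : 0 ≤ 4 * (T * L T) := by positivity
      linarith
    | succ k ih =>
      intro T hT hT'
      obtain ⟨h2, h3, h4⟩ := hT₁ T hT
      have hT0 : 0 < T := by linarith
      have hLT := L_nonneg h4
      have hTL : 0 ≤ T * L T := by positivity
      have hsq : 4 ≤ Real.log T ^ 2 := by nlinarith
      have h5 := zeroCount_le_add_pairCount hM hT0.le (by linarith : 1 ≤ Real.log T ^ 2)
      have h6 : (zeroCount (T / Real.log T ^ 2) : ℝ) ≤ zeroCount (T / 4) :=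
        zeroCount_mono (by gcongr)
      have h7 : (zeroCount (T / 4) : ℝ) ≤ T * L T + zeroCount T₁ := by
        rcases le_total (T / 4) T₁ with h | h
        · have : (zeroCount (T / 4) : ℝ) ≤ zeroCount T₁ := zeroCount_mono h
          linarith
        · have h8 := ih (T / 4) h (by rw [pow_succ] at hT'; linarith)
          have h9 : L (T / 4) ≤ L T := L_mono (by positivity) (by linarith)
          have h10 : T * L (T / 4) ≤ T * L T := by gcongr
          linarith
      linarith
  refine ⟨T₁, h1, fun T hT => ?_⟩
  obtain ⟨k, hk⟩ := pow_unbounded_of_one_lt T (show (1 : ℝ) < 4 by norm_num)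
  refine hstep k T hT (hk.le.trans ?_)
  exact le_mul_of_one_le_right (by positivity) h1

theorem eventually_zeroCount_div_log_sq_le {M : ℝ} (hM : 0 < M) (hp : HasLimitingDensity M 0 1)
    {ε : ℝ} (hε : 0 < ε) :
    ∀ᶠ T : ℝ in atTop, (zeroCount (T / Real.log T ^ 2) : ℝ) ≤ ε * (T * L T) := by
  obtain ⟨T₁, h1, hT₁⟩ := exists_zeroCount_le hM hp
  filter_upwards [Real.tendsto_log_atTop.eventually_ge_atTop
      (2 * Real.pi * (2 * zeroCount T₁ / ε) + 8 / ε + 1), eventually_ge_atTop 1] with T hlog hT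
  have hT0 : 0 < T := by linarith
  set ℓ := Real.log T with hℓ
  have h8 : 0 < 8 / ε := by positivity
  have hz : 0 ≤ 2 * Real.pi * (2 * zeroCount T₁ / ε) := by positivity
  have hℓ1 : 1 ≤ ℓ := by linarith
  have hℓ0 : 0 < ℓ := by linarith
  have hL : 0 ≤ L T := L_nonneg hT
  have hTL : 0 ≤ T * L T := by positivity
  have ha : 0 < T / ℓ ^ 2 := by positivity
  have haT : T / ℓ ^ 2 ≤ T := div_le_self hT0.le (one_le_pow₀ hℓ1)
  have h2 : (zeroCount (T / ℓ ^ 2) : ℝ) ≤ 4 * (T / ℓ ^ 2 * L T) + zeroCount T₁ := by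
    rcases le_total (T / ℓ ^ 2) T₁ with h | h
    · have h3 : (zeroCount (T / ℓ ^ 2) : ℝ) ≤ zeroCount T₁ := zeroCount_mono h
      have : 0 ≤ 4 * (T / ℓ ^ 2 * L T) := by positivity
      linarith
    · refine (hT₁ _ h).trans ?_
      have := L_mono ha haT
      gcongr
  have h3 : 4 * (T / ℓ ^ 2 * L T) ≤ ε / 2 * (T * L T) := by
    have h4 : 4 / ℓ ^ 2 ≤ ε / 2 := by
      rw [div_le_iff₀ (by positivity)]
      have h5 : 8 / ε ≤ ℓ := by linarith
      rw [div_le_iff₀ hε] at h5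
      nlinarith
    calc 4 * (T / ℓ ^ 2 * L T) = 4 / ℓ ^ 2 * (T * L T) := by ring
      _ ≤ _ := by gcongr
  have h6 : (zeroCount T₁ : ℝ) ≤ ε / 2 * (T * L T) := by
    have h7 : 2 * zeroCount T₁ / ε ≤ L T := by
      unfold L
      rw [le_div_iff₀ (by positivity)]
      linarith
    rw [div_le_iff₀ hε] at h7
    nlinarith
  linarith

theorem eventually_zeroCount_le {M : ℝ} (hM : 0 < M) (hp : HasLimitingDensity M 0 1)
    {ε : ℝ} (hε : 0 < ε) : ∀ᶠ T : ℝ in atTop, (zeroCount T : ℝ) ≤ (1 + ε) * (T * L T) := by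
  filter_upwards [eventually_zeroCount_div_log_sq_le hM hp (half_pos hε),
    eventually_pairCount_le hp (half_pos hε), eventually_ge_atTop 0,
    Real.tendsto_log_atTop.eventually_ge_atTop 1] with T h1 h2 h3 h4
  have := zeroCount_le_add_pairCount hM h3 (one_le_pow₀ h4)
  linarith

theorem exists_zeroCount_le_add {M : ℝ} (hM : 0 < M) (hp : HasLimitingDensity M 0 1)
    {ε : ℝ} (hε : 0 < ε) : ∃ B : ℝ, 0 ≤ B ∧ ∀ t : ℝ, 0 < t →
      (zeroCount t : ℝ) ≤ (1 + ε) / (2 * Real.pi) * (t * Real.log t) + B := by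
  obtain ⟨T₂, hT₂⟩ := eventually_atTop.mp (eventually_zeroCount_le hM hp hε)
  refine ⟨zeroCount T₂ + (1 + ε) / (2 * Real.pi), by positivity, fun t ht => ?_⟩
  have hc : 0 < (1 + ε) / (2 * Real.pi) := by positivity
  rcases le_total T₂ t with h | h
  · have h1 := hT₂ t h
    have h2 : (1 + ε) * (t * L t) = (1 + ε) / (2 * Real.pi) * (t * Real.log t) := by
      unfold L; ring
    have h3 : (0 : ℝ) ≤ zeroCount T₂ := by positivity
    linarith
  · have h1 : (zeroCount t : ℝ) ≤ zeroCount T₂ := zeroCount_mono h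
    -- For small t the main term may be negative; the extra constant in B compensates.
    have h2 : -1 ≤ t * Real.log t := by
      have h3 := Real.one_sub_inv_le_log_of_pos ht
      have h4 : t * (1 - t⁻¹) ≤ t * Real.log t := by gcongr
      rw [mul_sub, mul_inv_cancel₀ ht.ne'] at h4
      linarith
    nlinarith

theorem eventually_le_zeroCount {M : ℝ} (hM : 0 < M) (hp : HasLimitingDensity M 0 1)
    {η : ℝ} (hη : 0 < η) (hη1 : η < 1) :
    ∀ᶠ T : ℝ in atTop, (1 - η) * (T * L T) ≤ zeroCount T := by
  obtain ⟨g, hg, hgρ⟩ := exists_pos_le_im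
  obtain ⟨C, hC, hsum⟩ := exists_le_sum_log_zeros
  have := eventually_le_of_integral_lower_bound zeroCount_mono hg hC.le
    (fun ε hε => by
      obtain ⟨B, hB, h⟩ := exists_zeroCount_le_add hM hp hε
      exact ⟨B, hB, fun t ht => h t (hg.trans ht)⟩)
    (fun n hn G hG hle => zeroCount_integral_lower_bound hg hgρ hsum n hn G hG hle) hη hη1
  filter_upwards [this] with T hT
  refine le_trans (le_of_eq ?_) hT
  unfold L
  ring

theorem eventually_le_simpleCriticalZeroCount {M : ℝ} (hM : 0 < M)
    (hp : HasLimitingDensity M 0 1) {ε : ℝ} (hε : 0 < ε) (hε1 : ε ≤ 1 / 2) :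
    ∀ᶠ T : ℝ in atTop, 0 < (zeroCount T : ℝ) ∧
      (1 - 8 * ε) * zeroCount T ≤ simpleCriticalZeroCount T := by
  filter_upwards [eventually_zeroCount_div_log_sq_le hM hp hε, eventually_pairCount_le hp hε,
    eventually_le_zeroCount hM hp hε (by linarith), eventually_ge_atTop 0,
    Real.tendsto_log_atTop.eventually_ge_atTop 1, eventually_gt_atTop 1] with T h1 h2 h3 h4 h5 h6
  have h7 := two_mul_sum_mult_le (M := M) hM h4
  have h8 := sum_zerosBetween_add (a := T / Real.log T ^ 2) (by positivity)
    (div_le_self h4 (one_le_pow₀ h5))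
  have hTL : 0 < T * L T := by
    unfold L
    have := Real.pi_pos
    positivity
  have h9 : T * L T ≤ 2 * zeroCount T := by nlinarith
  refine ⟨by linarith, ?_⟩
  -- The count is at least 2N - (1 + 3ε)TL, and TL ≤ (1 + 2ε)N with TL ≤ 2N gives (1 + 3ε)TL ≤ (1 +
  -- 8ε)N.
  nlinarith

end Counting

end

theorem corollary1 (hAH : ZetaPairs.AHPairs) (M : ℝ) (hM : 0 < M)
    (hp : ZetaPairs.HasLimitingDensity M 0 1) :
    Tendsto
      (fun T : ℝ => (ZetaPairs.simpleCriticalZeroCount T : ℝ) / (ZetaPairs.zeroCount T : ℝ))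
      atTop (𝓝 1) := by
  refine tendsto_order.mpr ⟨fun a ha => ?_, fun a ha => ?_⟩
  -- With this choice 1 - 8ε ≥ (1 + a)/2 > a.
  · set ε := min (1 / 2) ((1 - a) / 16) with hε
    have hε0 : 0 < ε := lt_min (by norm_num) (by linarith)
    have hε1 : ε ≤ 1 / 2 := min_le_left _ _
    have hε2 : ε ≤ (1 - a) / 16 := min_le_right _ _
    filter_upwards [eventually_le_simpleCriticalZeroCount hM hp hε0 hε1] with T hT
    rw [lt_div_iff₀ hT.1]
    nlinarith [hT.1, hT.2]
  · filter_upwards with T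
    refine lt_of_le_of_lt (div_le_one_of_le₀ ?_ (by positivity)) ha
    exact_mod_cast simpleCriticalZeroCount_le T
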